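/- Let $s\in\mathbb{C}$ with $\Re s>-1/2$. For real $x$ put $$\rho(x)=|x|^{\Re s}e^{-\frac{\pi}{2}\Im s\,\operatorname{sign}x},\qquad \psi(x)=e^{-\frac{i\pi}{2}\Re s\,\operatorname{sign}x}|x|^{-i\Im s},\qquad Z_s(x)=\frac{\Gamma(1+s)}{\Gamma(1+2\Re s)}\,{}_1F_1(\bar s;1+2\Re s;ix),$$ where ${}_1F_1(a;b;z)=\sum_{k\ge0}\frac{(a)_k}{(b)_k\,k!}z^k$ (at $x=0$ read $\operatorname{sign}0=0$, $0^0=1$ and $0^{\alpha}=0$ for $\alpha\neq0$). Let $$\mathcal{T}_s(x)=\frac{e^{-ix}}{\sqrt{2\pi}}\,\rho(x)\overline{\psi(x)}Z_s(x),\qquad K^s(x,y)=\rho(x)\rho(y)\frac{Z_s(x)\overline{Z_s(y)}-e^{i(x-y)}\overline{Z_s(x)}Z_s(y)}{2\pi i(y-x)}\quad(x\ne y),$$ where for $x=y$ the quotient is defined by L'Hôpital's rule. Let $L_p=L_p(\mathbb{R})$ be the complex Lebesgue spaces, and for $f\in L_1\cap L_\infty$ let $$\mathcal{T}_sf(\omega)=\int_{\mathbb{R}}\mathcal{T}_s(\omega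 x)f(x)\,dx .$$ 1. The subspace $L_1\cap L_\infty$ is dense in $L_2$. For $f\in L_1\cap L_\infty$ the integral $\mathcal{T}_sf(\omega)$ converges absolutely for every $\omega\ne0$, $\mathcal{T}_sf\in L_2$ and $\|\mathcal{T}_sf\|_{L_2}=\|f\|_{L_2}$. 2. $\mathcal{T}_s$ extends from $L_1\cap L_\infty$ to a unitary operator on $L_2$, also denoted $\mathcal{T}_s$. There is a bounded operator $K^s$ on $L_2$ with kernel $K^s(x,y)$, that is, for every $f\in L_2$ and almost every $x$ the integral $\int_{\mathbb{R}}K^s(x,y)f(y)\,dy$ converges absolutely and equals $K^sf(x)$; and $$\mathcal{T}_s^*\,\mathbb{I}_{[0,1]}\,\mathcal{T}_s=\psi K^s\psi^*,$$ where $\mathbb{I}_{[0,1]}$ (the indicator function of $[0,1]$) and $\psi$ stand for the operators of pointwise multiplication by these functions. 3. For all real $x,y$ the following integral converges absolutely, and $$\int_0^1\overline{\mathcal{T}_s(xt)}\,\mathcal{T}_s(yt)\,dt=\psi(x)K^s(x,y)\overline{\psi(y)}.$$ 4. For $s=0$ the transform is the Fourier transform: $\mathcal{T}_0f(\omega)=\mathcal{F}f(\omega)=\frac1{\sqrt{2\pi}}\int_{\mathbb{R}}e^{-i\omega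 x}f(x)\,dx$. -/

import Mathlib

open MeasureTheory
open scoped ENNReal ComplexConjugate

noncomputable section

namespace ConfluentHG

/-- The complex Hilbert space `L²(ℝ)` with respect to Lebesgue measure. -/
abbrev L2 : Type := Lp ℂ 2 (volume : Measure ℝ)

/-- The confluent hypergeometric function
`₁F₁(a; b; z) = ∑ₖ (a)ₖ / ((b)ₖ k!) zᵏ`, where `(a)ₖ = a (a + 1) ⋯ (a + k - 1)`. -/
def hyp1F1 (a b z : ℂ) : ℂ :=
  ∑' k : ℕ, (ascPochhammer ℂ k).eval a / ((ascPochhammer ℂ k).eval b * (k.factorial : ℂ)) * z ^ k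

/-- `ρ(x) = |x|^{Re s} e^{-(π/2) Im s sign x}`. -/
def rho (s : ℂ) (x : ℝ) : ℝ :=
  |x| ^ s.re * Real.exp (-(Real.pi / 2) * s.im * Real.sign x)

/-- `Z_s(x) = Γ(1 + s) / Γ(1 + 2 Re s) · ₁F₁(conj s; 1 + 2 Re s; i x)`. -/
def Z (s : ℂ) (x : ℝ) : ℂ :=
  Complex.Gamma (1 + s) / Complex.Gamma (1 + 2 * (s.re : ℂ)) *
    hyp1F1 (conj s) (1 + 2 * (s.re : ℂ)) (Complex.I * (x : ℂ))

/-- `ψ(x) = e^{-(iπ/2) Re s sign x} |x|^{-i Im s}`. -/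
def psi (s : ℂ) (x : ℝ) : ℂ :=
  Complex.exp (-(Complex.I * (Real.pi : ℂ) / 2) * (s.re : ℂ) * (Real.sign x : ℂ)) *
    ((|x| : ℝ) : ℂ) ^ (-(Complex.I * (s.im : ℂ)))

/-- The numerator `Z_s(x) conj(Z_s(y)) - e^{i(x-y)} conj(Z_s(x)) Z_s(y)`. -/
def kernelNum (s : ℂ) (x y : ℝ) : ℂ :=
  Z s x * conj (Z s y) - Complex.exp (Complex.I * ((x : ℂ) - (y : ℂ))) * conj (Z s x) * Z s y

/-- The confluent hypergeometric kernel `K^s(x, y)`. On the diagonal the quotient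
`kernelNum s x y / (2πi (y - x))` is given its value by L'Hôpital's rule in `y`. -/
def kernel (s : ℂ) (x y : ℝ) : ℂ :=
  (rho s x : ℂ) * (rho s y : ℂ) *
    (if x = y then deriv (fun u : ℝ => kernelNum s x u) x / (2 * (Real.pi : ℂ) * Complex.I)
      else kernelNum s x y / (2 * (Real.pi : ℂ) * Complex.I * ((y : ℂ) - (x : ℂ))))

/-- The generalized exponent `𝒯_s(x) = e^{-ix} / √(2π) · ρ(x) conj(ψ(x)) Z_s(x)`. -/
def genExp (s : ℂ) (x : ℝ) : ℂ :=
  Complex.exp (-(Complex.I * (x : ℂ))) / (Real.sqrt (2 * Real.pi) : ℂ) *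
    (rho s x : ℂ) * conj (psi s x) * Z s x

/-- The transform `𝒯_s f(ω) = ∫ 𝒯_s(ω x) f(x) dx`. -/
def transform (s : ℂ) (f : ℝ → ℂ) (ω : ℝ) : ℂ :=
  ∫ x : ℝ, genExp s (ω * x) * f x

/-- The Fourier transform `ℱ f(ω) = (2π)^{-1/2} ∫ e^{-iωx} f(x) dx`. -/
def fourier (f : ℝ → ℂ) (ω : ℝ) : ℂ :=
  1 / (Real.sqrt (2 * Real.pi) : ℂ) *
    ∫ x : ℝ, Complex.exp (-(Complex.I * (ω : ℂ) * (x : ℂ))) * f x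

/-- The bounded operator on `L²(ℝ)` of pointwise multiplication by `φ ∈ L^∞(ℝ)`. -/
def mulOp (φ : ℝ → ℂ) (hφ : MemLp φ ∞ (volume : Measure ℝ)) : L2 →L[ℂ] L2 :=
  (ContinuousLinearMap.mul ℂ ℂ).holderL (volume : Measure ℝ) ∞ 2 2 (hφ.toLp φ)

theorem coeFn_mulOp (φ : ℝ → ℂ) (hφ : MemLp φ ∞ (volume : Measure ℝ)) (f : L2) :
    ∀ᵐ x : ℝ, mulOp φ hφ f x = φ x * f x := by
  have h := (ContinuousLinearMap.mul ℂ ℂ).coeFn_holder (r := 2) (hφ.toLp φ) f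
  filter_upwards [h, hφ.coeFn_toLp] with x hx hx'
  rw [hx'] at hx
  exact hx

/-- `A` is the integral operator on `L²(ℝ)` with kernel `k`: for every `f ∈ L²(ℝ)` and almost
every `x`, the integral `∫ k(x, y) f(y) dy` converges absolutely and equals `(A f)(x)`. -/
def IsIntegralOperator (k : ℝ → ℝ → ℂ) (A : L2 →L[ℂ] L2) : Prop :=
  ∀ f : L2, ∀ᵐ x : ℝ,
    Integrable (fun y : ℝ => k x y * f y) ∧ A f x = ∫ y : ℝ, k x y * f y

theorem memLp_psi (s : ℂ) : MemLp (psi s) ∞ (volume : Measure ℝ) := by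
  have hsign : Measurable Real.sign := by
    unfold Real.sign
    exact Measurable.ite measurableSet_Iio measurable_const
      (Measurable.ite measurableSet_Ioi measurable_const measurable_const)
  have hm : Measurable (psi s) := by
    unfold psi
    refine Measurable.mul ?_ ?_
    · exact Complex.measurable_exp.comp
        ((Complex.measurable_ofReal.comp hsign).const_mul _)
    · exact (Complex.measurable_ofReal.comp measurable_norm).pow_const _
  refine memLp_top_of_bound hm.aestronglyMeasurable 1 (Filter.Eventually.of_forall fun x => ?_)
  unfold psi
  rw [norm_mul, Complex.norm_exp]
  have h1 : (-(Complex.I * (Real.pi : ℂ) / 2) * (s.re : ℂ) * (Real.sign x : ℂ)).re = 0 := by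
    simp
  rw [h1, Real.exp_zero, one_mul]
  rcases eq_or_ne x 0 with rfl | hx
  · rw [abs_zero, Complex.ofReal_zero]
    by_cases h : -(Complex.I * (s.im : ℂ)) = 0
    · rw [h]; simp
    · rw [Complex.zero_cpow h]; simp
  · rw [Complex.norm_cpow_eq_rpow_re_of_pos (abs_pos.mpr hx)]
    simp

/-- The indicator function of `[0, 1]`. -/
def unitInd : ℝ → ℂ := Set.indicator (Set.Icc (0 : ℝ) 1) (fun _ => (1 : ℂ))

theorem memLp_unitInd : MemLp unitInd ∞ (volume : Measure ℝ) :=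
  (memLp_top_const (1 : ℂ)).indicator measurableSet_Icc

end ConfluentHG

end

noncomputable section

namespace ConfluentHG

/-! ### The confluent hypergeometric series -/

/-! Kernel identity. Kummer's transformation turns the contiguous relation for ₁F₁ into a first
order equation that couples `Z` only to its own conjugate: x Z' = s̄ (κ e^{ix} Z̄ - Z) with |κ| = 1
(`exists_hasDerivAt_Z`). Substituted into the numerator N(xt, yt) of the kernel, it makes t^{2 Re s}
N(xt, yt) an antiderivative of i(y - x) t^{2 Re s} e^{i(x-y)t} conj(Z(xt)) Z(yt). Integration over
[0, 1] gives the kernel off the diagonal, and continuity in y gives L'Hôpital's value on it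
(`kernel_eq_integral`).

Growth. The same equation bounds |x|^{Re s} |Z(x)| for |x| ≥ 1, by an energy estimate in which the
oscillating part is integrated once by parts (`exists_rpow_mul_norm_Z_le_of_large`). Hence |𝒯_s(ωx)|
≤ C w(ω) w(x) for a weight w with at most an integrable singularity at 0. This justifies absolute
convergence and every use of Fubini.

Isometry. The test functions are x^{s̄} e^{-px}, p > 0, on either half-line. Since ρ(x) conj(ψ(x)) =
(ix)^s, their transforms are Laplace transforms of x^{2 Re s} e^{-iωx} Z(ωx), which are elementary:
Γ(1+s) (p+iω)^{-(1+s)} p^{-s̄} (`laplace_Z`). After ω = -1/η the result is, up to a constant and the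
factor η that absorbs the Jacobian, the Fourier transform of x^s e^{-x/p}
(`transform_powExp_comp_neg_inv`). Plancherel therefore computes all inner products of the
transforms, and they agree with those of the test functions
(`integral_conj_transform_mul_transform`). The family is total by Weierstrass approximation in u =
e^{-x}, so there is an isometry U with the prescribed values on it.

Unitarity and the operator K. As 𝒯_s(ωx) is symmetric in ω and x, U is symmetric for the bilinear
pairing ∫ f g. This identifies U with the integral wherever the integral converges against w, and it
gives U* = conj ∘ U ∘ conj, so that U is onto. The operator K is taken to be ψ* U* 𝕀 U ψ. Moving U
across the pairing shows that its kernel is the integral over [0, 1] computed in the first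
paragraph. -/

theorem ascPochhammer_eval_ne_zero {b : ℂ} (hb : 0 < b.re) (k : ℕ) :
    (ascPochhammer ℂ k).eval b ≠ 0 := by
  induction k with
  | zero => simp
  | succ k ih =>
    rw [ascPochhammer_succ_eval]
    refine mul_ne_zero ih fun h => ?_
    have := congrArg Complex.re h
    simp at this
    have hk : (0 : ℝ) ≤ k := Nat.cast_nonneg k
    linarith

/-- The coefficients of the confluent hypergeometric series. -/
def hypCoeff (a b : ℂ) (k : ℕ) : ℂ :=
  (ascPochhammer ℂ k).eval a / ((ascPochhammer ℂ k).eval b * (k.factorial : ℂ))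

theorem hyp1F1_eq (a b z : ℂ) : hyp1F1 a b z = ∑' k : ℕ, hypCoeff a b k * z ^ k := rfl

theorem hypCoeff_succ (a b : ℂ) (k : ℕ) :
    hypCoeff a b (k + 1) = hypCoeff a b k * ((a + k) / ((b + k) * (k + 1))) := by
  unfold hypCoeff
  rw [ascPochhammer_succ_eval, ascPochhammer_succ_eval, Nat.factorial_succ, div_mul_div_comm]
  push_cast
  congr 1
  ring

theorem norm_add_div_le {b : ℂ} (hb : 0 < b.re) (a : ℂ) {k : ℕ} (hk : 1 ≤ k) :
    ‖(a + k) / (b + k)‖ ≤ ‖a‖ + 1 := by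
  have hk' : (1 : ℝ) ≤ k := by exact_mod_cast hk
  have h1 : (k : ℝ) ≤ ‖b + k‖ := by
    refine le_trans ?_ (Complex.re_le_norm _)
    simp
    linarith
  rw [norm_div, div_le_iff₀ (by linarith)]
  calc ‖a + k‖ ≤ ‖a‖ + k := by simpa using norm_add_le a (k : ℂ)
    _ ≤ (‖a‖ + 1) * k := by nlinarith [norm_nonneg a]
    _ ≤ _ := by gcongr

theorem summable_norm_hypCoeff {b : ℂ} (hb : 0 < b.re) (a z : ℂ) :
    Summable fun k => ‖hypCoeff a b k * z ^ k‖ := by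
  obtain ⟨N, hN⟩ := exists_nat_gt (2 * ((‖a‖ + 1) * ‖z‖))
  refine summable_of_ratio_norm_eventually_le (r := 1 / 2) (by norm_num) ?_
  filter_upwards [Filter.eventually_ge_atTop (max N 1)] with k hk
  have hk1 : 1 ≤ k := le_trans (le_max_right _ _) hk
  have hkN : (N : ℝ) ≤ k := by exact_mod_cast le_trans (le_max_left _ _) hk
  have h := norm_add_div_le hb a hk1
  have hpos : (0 : ℝ) < (k : ℝ) + 1 := by positivity
  have e : hypCoeff a b (k + 1) * z ^ (k + 1) =
      (((a + k) / (b + k)) * z / (k + 1)) * (hypCoeff a b k * z ^ k) := by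
    rw [hypCoeff_succ, pow_succ, ← div_div]
    ring
  rw [norm_norm, norm_norm, e, norm_mul]
  gcongr
  rw [norm_div, norm_mul]
  have hc : ‖(k : ℂ) + 1‖ = (k : ℝ) + 1 := by
    have := Complex.norm_natCast (k + 1)
    push_cast at this
    exact this
  rw [hc, div_le_iff₀ hpos]
  have : ‖(a + k) / (b + k)‖ * ‖z‖ ≤ (‖a‖ + 1) * ‖z‖ := by gcongr
  linarith

/-- The factor k from differentiation is absorbed by k ≤ 2^k, so on the ball of radius R the series
of derivatives is dominated by the series at 2R. -/
theorem hasDerivAt_tsum_mul_pow {c : ℕ → ℂ} (hc : ∀ z : ℂ, Summable fun k => ‖c k * z ^ k‖)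
    (z : ℂ) :
    HasDerivAt (fun w => ∑' k, c k * w ^ k) (∑' k, c k * (k * z ^ (k - 1))) z := by
  set R : ℝ := ‖z‖ + 1 with hR
  have hR1 : 1 ≤ R := by rw [hR]; linarith [norm_nonneg z]
  have hu : Summable fun k : ℕ => ‖c k * ((2 * R : ℝ) : ℂ) ^ k‖ := hc _
  refine hasDerivAt_tsum_of_isPreconnected (𝕜 := ℂ) (F := ℂ) (g := fun k w => c k * w ^ k)
    (g' := fun k w => c k * (k * w ^ (k - 1))) (t := Metric.ball (0 : ℂ) R) (y₀ := z)
      hu Metric.isOpen_ball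
    (convex_ball (0 : ℂ) R).isPreconnected ?_ ?_ ?_ ?_ ?_
  · intro n y _
    exact (hasDerivAt_pow n y).const_mul (c n)
  · intro n y hy
    have hy' : ‖y‖ ≤ R := by simpa using (Metric.mem_ball.1 hy).le
    rw [norm_mul, norm_mul, norm_mul, norm_pow, norm_pow, Complex.norm_natCast, Complex.norm_real,
      Real.norm_of_nonneg (by positivity), mul_pow]
    gcongr
    · exact_mod_cast Nat.lt_two_pow_self.le
    · calc ‖y‖ ^ (n - 1) ≤ R ^ (n - 1) := by gcongr
        _ ≤ R ^ n := pow_le_pow_right₀ hR1 (by omega)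
  · simp [hR]
  · exact (hc z).of_norm
  · simp [hR]

/-- This rests on a (a+1)_k = (a+k) (a)_k, and is the coefficient form of the contiguous relation.
-/
theorem mul_hypCoeff {b : ℂ} (a : ℂ) (k : ℕ) :
    (k : ℂ) * hypCoeff a b k = a * (hypCoeff (a + 1) b k - hypCoeff a b k) := by
  have h : ∀ k : ℕ, a * (ascPochhammer ℂ k).eval (a + 1) =
      (a + k) * (ascPochhammer ℂ k).eval a := by
    intro k
    induction k with
    | zero => simp
    | succ k ih =>
      rw [ascPochhammer_succ_eval, ascPochhammer_succ_eval, ← mul_assoc, ih]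
      push_cast
      ring
  unfold hypCoeff
  linear_combination (-1 / ((ascPochhammer ℂ k).eval b * (k.factorial : ℂ))) * h k

/-- `z M'(z) = a (M(a + 1, b, z) - M(a, b, z))` for `M = ₁F₁`. -/
theorem exists_hasDerivAt_hyp1F1 {b : ℂ} (hb : 0 < b.re) (a z : ℂ) :
    ∃ d : ℂ, HasDerivAt (hyp1F1 a b) d z ∧ z * d = a * (hyp1F1 (a + 1) b z - hyp1F1 a b z) := by
  refine ⟨_, hasDerivAt_tsum_mul_pow (summable_norm_hypCoeff hb a) z, ?_⟩
  rw [hyp1F1_eq, hyp1F1_eq, ← tsum_mul_left,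
    ← (summable_norm_hypCoeff hb (a + 1) z).of_norm.tsum_sub
      (summable_norm_hypCoeff hb a z).of_norm,
    ← tsum_mul_left]
  refine tsum_congr fun k => ?_
  have h := mul_hypCoeff (b := b) a k
  rcases k with _ | k
  · simp [hypCoeff]
  · rw [← sub_mul, ← mul_assoc a, ← h]
    simp only [Nat.add_sub_cancel, pow_succ]
    ring

theorem ascPochhammer_succ_eval_left (n : ℕ) (b : ℂ) :
    (ascPochhammer ℂ (n + 1)).eval b = b * (ascPochhammer ℂ n).eval (b + 1) := by
  induction n with
  | zero => simp
  | succ n ih =>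
    rw [ascPochhammer_succ_eval, ih, ascPochhammer_succ_eval]
    push_cast
    ring

/-- The Chu–Vandermonde identity. -/
theorem sum_choose_mul_ascPochhammer_div (n : ℕ) (a : ℂ) {b : ℂ} (hb : 0 < b.re) :
    ∑ k ∈ Finset.range (n + 1), (n.choose k : ℂ) * (-1) ^ k *
      ((ascPochhammer ℂ k).eval a / (ascPochhammer ℂ k).eval b) =
      (ascPochhammer ℂ n).eval (b - a) / (ascPochhammer ℂ n).eval b := by
  induction n generalizing b with
  | zero => simp
  | succ n ih =>
    set g : ℕ → ℂ := fun k => (ascPochhammer ℂ k).eval a / (ascPochhammer ℂ k).eval b with hg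
    have hb1 : 0 < (b + 1).re := by simp; linarith
    have hb0 : b ≠ 0 := by rintro rfl; simp at hb
    -- Differences of (a)_k / (b)_k are multiples of (a)_k / (b+1)_k, so Pascal's rule reduces (n +
    -- 1, b) to (n, b + 1).
    have hdiff : ∀ k, g k - g (k + 1) =
        (b - a) / b * ((ascPochhammer ℂ k).eval a / (ascPochhammer ℂ k).eval (b + 1)) := by
      intro k
      have h1 := ascPochhammer_eval_ne_zero hb k
      have h2 := ascPochhammer_eval_ne_zero hb1 k
      have h3 := ascPochhammer_eval_ne_zero hb (k + 1)
      have h4 := ascPochhammer_succ_eval_left k b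
      have h5 := ascPochhammer_succ_eval k b
      simp only [hg]
      rw [h5] at h4 h3
      have h6 : b + k ≠ 0 := right_ne_zero_of_mul h3
      have e1 : (ascPochhammer ℂ k).eval (b + 1) = (ascPochhammer ℂ k).eval b * (b + k) / b := by
        rw [h4]; field_simp
      rw [ascPochhammer_succ_eval, h5, e1]
      field_simp
      ring
    have hpascal : ∑ k ∈ Finset.range (n + 1 + 1), ((n + 1).choose k : ℂ) * (-1) ^ k * g k =
        ∑ k ∈ Finset.range (n + 1), (n.choose k : ℂ) * (-1) ^ k * (g k - g (k + 1)) := by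
      rw [Finset.sum_range_succ']
      simp only [Nat.choose_succ_succ, Nat.cast_add, add_mul, Finset.sum_add_distrib, mul_sub,
        Finset.sum_sub_distrib]
      have e2 : ∑ k ∈ Finset.range (n + 1), (n.choose k : ℂ) * (-1) ^ k * g k =
          ∑ k ∈ Finset.range (n + 1), (n.choose (k + 1) : ℂ) * (-1) ^ (k + 1) * g (k + 1) +
            g 0 := by
        have := Finset.sum_range_succ' (fun k => (n.choose k : ℂ) * (-1) ^ k * g k) (n + 1)
        rw [Finset.sum_range_succ] at this
        simpa using this
      have e3 : ∑ k ∈ Finset.range (n + 1), (n.choose k : ℂ) * (-1) ^ (k + 1) * g (k + 1) =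
          -∑ k ∈ Finset.range (n + 1), (n.choose k : ℂ) * (-1) ^ k * g (k + 1) := by
        rw [← Finset.sum_neg_distrib]
        exact Finset.sum_congr rfl fun k _ => by ring
      rw [e2, e3]
      simp
      ring
    rw [hpascal]
    simp only [hdiff]
    have := ih hb1
    calc _ = (b - a) / b * ∑ k ∈ Finset.range (n + 1), (n.choose k : ℂ) * (-1) ^ k *
          ((ascPochhammer ℂ k).eval a / (ascPochhammer ℂ k).eval (b + 1)) := by
          rw [Finset.mul_sum]
          exact Finset.sum_congr rfl fun k _ => by ring
      _ = _ := by
          rw [this, ascPochhammer_succ_eval_left, ascPochhammer_succ_eval_left,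
            div_mul_div_comm, add_sub_right_comm]

/-- Kummer's transformation. -/
theorem hyp1F1_eq_exp_mul {b : ℂ} (hb : 0 < b.re) (a z : ℂ) :
    hyp1F1 a b z = Complex.exp z * hyp1F1 (b - a) b (-z) := by
  have hexp : Summable fun n : ℕ => ‖z ^ n / (n.factorial : ℂ)‖ :=
    NormedSpace.norm_expSeries_div_summable z
  have h2 := summable_norm_hypCoeff hb (b - a) (-z)
  rw [hyp1F1_eq, hyp1F1_eq, Complex.exp_eq_exp_ℂ, NormedSpace.exp_eq_tsum_div, mul_comm,
    tsum_mul_tsum_eq_tsum_sum_antidiagonal_of_summable_norm h2 hexp]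
  refine tsum_congr fun n => ?_
  rw [Finset.Nat.sum_antidiagonal_eq_sum_range_succ_mk]
  -- With b - a in place of a, Chu–Vandermonde evaluates the n-th coefficient of the Cauchy product
  -- with e^z.
  have h := sum_choose_mul_ascPochhammer_div n (b - a) hb
  rw [sub_sub_cancel] at h
  have hn : (n.factorial : ℂ) ≠ 0 := by exact_mod_cast n.factorial_ne_zero
  have e : hypCoeff a b n * z ^ n = z ^ n / n.factorial *
      ((ascPochhammer ℂ n).eval a / (ascPochhammer ℂ n).eval b) := by
    unfold hypCoeff
    rw [← div_div]
    ring
  rw [e, ← h, Finset.mul_sum]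
  refine Finset.sum_congr rfl fun k hk => ?_
  have hkn : k ≤ n := Nat.lt_succ_iff.1 (Finset.mem_range.1 hk)
  have hk0 : (k.factorial : ℂ) ≠ 0 := by exact_mod_cast k.factorial_ne_zero
  have hnk0 : ((n - k).factorial : ℂ) ≠ 0 := by exact_mod_cast (n - k).factorial_ne_zero
  have hb0 := ascPochhammer_eval_ne_zero hb k
  rw [Nat.cast_choose ℂ hkn]
  have hz : z ^ n = z ^ k * z ^ (n - k) := by rw [← pow_add, Nat.add_sub_cancel' hkn]
  unfold hypCoeff
  rw [neg_pow z k, hz]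
  field_simp

theorem hyp1F1_conj (a b z : ℂ) : conj (hyp1F1 a b z) = hyp1F1 (conj a) (conj b) (conj z) := by
  have h : ∀ (k : ℕ) (w : ℂ), conj ((ascPochhammer ℂ k).eval w) =
      (ascPochhammer ℂ k).eval (conj w) := by
    intro k w
    induction k with
    | zero => simp
    | succ k ih => rw [ascPochhammer_succ_eval, ascPochhammer_succ_eval, map_mul, ih]; simp
  rw [hyp1F1, hyp1F1, Complex.conj_tsum]
  simp [h]

theorem continuous_hyp1F1 {b : ℂ} (hb : 0 < b.re) (a : ℂ) : Continuous (hyp1F1 a b) :=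
  continuous_iff_continuousAt.2 fun z =>
    let ⟨_, h, _⟩ := exists_hasDerivAt_hyp1F1 hb a z
    h.continuousAt

/-! ### The function `Z` -/

theorem one_add_two_re_pos {s : ℂ} (hs : -(1 / 2 : ℝ) < s.re) : 0 < (1 + 2 * (s.re : ℂ)).re := by
  simp
  linarith

/-- The normalizing constant `Γ(1 + s) / Γ(1 + 2 Re s)`. -/
def zConst (s : ℂ) : ℂ := Complex.Gamma (1 + s) / Complex.Gamma (1 + 2 * (s.re : ℂ))

theorem Gamma_one_add_ne_zero {s : ℂ} (hs : -(1 / 2 : ℝ) < s.re) : Complex.Gamma (1 + s) ≠ 0 :=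
  Complex.Gamma_ne_zero_of_re_pos (by simp; linarith)

theorem zConst_ne_zero {s : ℂ} (hs : -(1 / 2 : ℝ) < s.re) : zConst s ≠ 0 :=
  div_ne_zero (Gamma_one_add_ne_zero hs) (Complex.Gamma_ne_zero_of_re_pos (one_add_two_re_pos hs))

theorem conj_zConst (s : ℂ) : conj (zConst s) = zConst (conj s) := by
  unfold zConst
  rw [map_div₀, ← Complex.Gamma_conj, ← Complex.Gamma_conj]
  simp [map_ofNat]

theorem Z_eq (s : ℂ) (x : ℝ) :
    Z s x = zConst s * hyp1F1 (conj s) (1 + 2 * (s.re : ℂ)) (Complex.I * x) := rfl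

theorem conj_Z (s : ℂ) (x : ℝ) :
    conj (Z s x) = conj (zConst s) * hyp1F1 s (1 + 2 * (s.re : ℂ)) (-(Complex.I * x)) := by
  rw [Z_eq, map_mul, hyp1F1_conj]
  simp [map_ofNat]

theorem Z_neg (s : ℂ) (x : ℝ) : Z s (-x) = conj (Z (conj s) x) := by
  rw [conj_Z, Z_eq, conj_zConst]
  simp

theorem continuous_Z {s : ℂ} (hs : -(1 / 2 : ℝ) < s.re) : Continuous (Z s) := by
  have : Z s = fun x : ℝ => zConst s * hyp1F1 (conj s) (1 + 2 * (s.re : ℂ)) (Complex.I * x) := rfl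
  rw [this]
  exact continuous_const.mul ((continuous_hyp1F1 (one_add_two_re_pos hs) _).comp (by fun_prop))

/-- The first order differential equation of `Z`. -/
theorem exists_hasDerivAt_Z {s : ℂ} (hs : -(1 / 2 : ℝ) < s.re) (x : ℝ) :
    ∃ d : ℂ, HasDerivAt (Z s) d x ∧ x * d = conj s * (zConst s / conj (zConst s) *
      Complex.exp (Complex.I * x) * conj (Z s x) - Z s x) := by
  have hb := one_add_two_re_pos hs
  obtain ⟨d, hd, hd'⟩ := exists_hasDerivAt_hyp1F1 hb (conj s) (Complex.I * x)
  have h1 : HasDerivAt (fun y : ℝ => Complex.I * (y : ℂ)) Complex.I x := by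
    simpa using (Complex.ofRealCLM.hasDerivAt (x := x)).const_mul Complex.I
  have h2 : HasDerivAt (fun y : ℝ => hyp1F1 (conj s) (1 + 2 * (s.re : ℂ)) (Complex.I * y))
      (d * Complex.I) x := HasDerivAt.comp (h₂ := hyp1F1 (conj s) (1 + 2 * (s.re : ℂ))) x hd h1
  refine ⟨zConst s * (d * Complex.I), h2.const_mul (zConst s), ?_⟩
  -- Kummer sends the parameter s̄ + 1 to 1 + 2 Re s - (s̄ + 1) = s, so the shifted function is
  -- e^{ix} times the conjugate of the original one.
  have hK := hyp1F1_eq_exp_mul hb (conj s + 1) (Complex.I * x)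
  have e : 1 + 2 * (s.re : ℂ) - (conj s + 1) = s := by
    have := Complex.add_conj s
    push_cast at this
    linear_combination -this
  rw [e] at hK
  have hc : conj (zConst s) ≠ 0 := by simpa using zConst_ne_zero hs
  rw [conj_Z, Z_eq]
  have e2 : zConst s / conj (zConst s) * Complex.exp (Complex.I * x) *
      (conj (zConst s) * hyp1F1 s (1 + 2 * (s.re : ℂ)) (-(Complex.I * x))) =
      zConst s * hyp1F1 (conj s + 1) (1 + 2 * (s.re : ℂ)) (Complex.I * x) := by
    rw [hK]; field_simp
  rw [e2]
  linear_combination zConst s * hd'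

/-! ### Growth of `Z` at infinity -/

theorem norm_zConst_div_conj {s : ℂ} (hs : -(1 / 2 : ℝ) < s.re) :
    ‖zConst s / conj (zConst s)‖ = 1 := by
  rw [norm_div, Complex.norm_conj, div_self]
  exact norm_ne_zero_iff.2 (zConst_ne_zero hs)

/-- A Gronwall type bound. -/
theorem bounded_of_deriv_le_div_sq {G G' : ℝ → ℝ} {X C : ℝ} (hX : 0 < X)
    (hG : ∀ x, X ≤ x → HasDerivAt G (G' x) x) (hG0 : ∀ x, X ≤ x → 0 ≤ G x) (hC : 0 ≤ C)
    (hle : ∀ x, X ≤ x → G' x ≤ C / x ^ 2 * G x) {x : ℝ} (hx : X ≤ x) :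
    G x ≤ G X * Real.exp (C / X) := by
  -- e^{C/x} is the integrating factor, because (C/x)' = -C/x².
  have hder : ∀ x, X ≤ x → HasDerivAt (fun x => G x * Real.exp (C / x))
      (G' x * Real.exp (C / x) + G x * (Real.exp (C / x) * (C * (-(x ^ 2)⁻¹)))) x := by
    intro x hx
    have hx0 : x ≠ 0 := by linarith
    have h2 : HasDerivAt (fun x => C / x) (C * (-(x ^ 2)⁻¹)) x := by
      simpa only [div_eq_mul_inv] using (hasDerivAt_inv hx0).const_mul C
    exact (hG x hx).mul h2.exp
  have hanti : AntitoneOn (fun x => G x * Real.exp (C / x)) (Set.Ici X) := by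
    refine antitoneOn_of_deriv_nonpos (convex_Ici X)
      (fun x hx => (hder x hx).continuousAt.continuousWithinAt)
      (fun x hx => ?_) (fun x hx => ?_)
    · rw [interior_Ici] at hx
      exact (hder x (le_of_lt hx)).differentiableAt.differentiableWithinAt
    · rw [interior_Ici] at hx
      have hx' : X ≤ x := le_of_lt hx
      rw [(hder x hx').deriv]
      have e : G' x * Real.exp (C / x) + G x * (Real.exp (C / x) * (C * (-(x ^ 2)⁻¹))) =
          Real.exp (C / x) * (G' x - C / x ^ 2 * G x) := by rw [div_eq_mul_inv C (x ^ 2)]; ring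
      rw [e]
      exact mul_nonpos_of_nonneg_of_nonpos (Real.exp_pos _).le (by linarith [hle x hx'])
  have h := hanti (Set.mem_Ici.2 le_rfl) (Set.mem_Ici.2 hx) hx
  refine le_trans ?_ h
  have : 1 ≤ Real.exp (C / x) := Real.one_le_exp (div_nonneg hC (by linarith))
  nlinarith [hG0 x hx]

/-- For the energy v = x^{2 Re s} |Z|², the non-oscillating part of v' cancels. What remains is of
size v/x but carries e^{ix}. Subtracting the approximate primitive 2 Re Q leaves an error O(v/x²),
which is integrable at infinity, and Gronwall applies. -/
theorem exists_rpow_mul_norm_Z_le_of_large {s : ℂ} (hs : -(1 / 2 : ℝ) < s.re) :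
    ∃ X B : ℝ, 1 ≤ X ∧ ∀ x : ℝ, X ≤ x → x ^ (2 * s.re) * ‖Z s x‖ ^ 2 ≤ B := by
  choose d hd hd' using exists_hasDerivAt_Z hs
  set κ := zConst s / conj (zConst s) with hκ
  have hκ1 : ‖κ‖ = 1 := norm_zConst_div_conj hs
  -- |Q| = ‖s‖ v/x, so x ≥ 4‖s‖ ensures 2 Re Q ≤ v/2 and the corrected energy stays comparable with
  -- v.
  set X : ℝ := 4 * ‖s‖ + 1 with hX
  have hX1 : 1 ≤ X := by rw [hX]; linarith [norm_nonneg s]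
  set a := s.re with ha
  set v : ℝ → ℝ := fun x => x ^ (2 * a) * ‖Z s x‖ ^ 2 with hv
  set Q : ℝ → ℂ := fun x => conj s * κ / Complex.I * Complex.exp (Complex.I * x) *
    conj (Z s x) ^ 2 * (x ^ (2 * a - 1) : ℝ) with hQ
  set v' : ℝ → ℝ := fun x => x ^ (2 * a - 1) *
    (2 * (conj s * κ * Complex.exp (Complex.I * x) * conj (Z s x) ^ 2).re) with hv'
  -- The part of Q' in which the derivative falls on conj(Z)² x^{2 Re s - 1} instead of on e^{ix}.
  set R : ℝ → ℂ := fun x => conj s * κ / Complex.I * Complex.exp (Complex.I * x) *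
    (2 * conj (Z s x) * (x * conj (d x)) + (2 * a - 1 : ℝ) * conj (Z s x) ^ 2) *
      (x ^ (2 * a - 2) : ℝ) with hR
  have hexp : ∀ x : ℝ, ‖Complex.exp (Complex.I * x)‖ = 1 := fun x => by
    rw [mul_comm, Complex.norm_exp_ofReal_mul_I]
  have hrp1 : ∀ x : ℝ, 0 < x → x ^ (2 * a) = x ^ (2 * a - 1) * x := fun x hx => by
    rw [← Real.rpow_add_one hx.ne']; congr 1; ring
  have hrp2 : ∀ x : ℝ, 0 < x → x ^ (2 * a - 1) = x ^ (2 * a - 2) * x := fun x hx => by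
    rw [← Real.rpow_add_one hx.ne']; congr 1; ring
  have hvder : ∀ x, X ≤ x → HasDerivAt v (v' x) x := by
    intro x hx
    have hx0 : 0 < x := by linarith
    have h1 : HasDerivAt (fun x : ℝ => ‖Z s x‖ ^ 2) (2 * (conj (Z s x) * d x).re) x := by
      have := (hd x).norm_sq
      convert this using 1
      simp [Complex.inner, mul_comm]
    have h2 := (Real.hasDerivAt_rpow_const (p := 2 * a) (Or.inl hx0.ne')).mul h1
    refine HasDerivAt.congr_deriv (f := v) h2 ?_
    simp only [hv']
    rw [hrp1 x hx0]
    have h3 : x * (conj (Z s x) * d x).re =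
        (conj s * κ * Complex.exp (Complex.I * x) * conj (Z s x) ^ 2).re - a * ‖Z s x‖ ^ 2 := by
      have e : ((x * (conj (Z s x) * d x).re : ℝ)) = ((x : ℂ) * (conj (Z s x) * d x)).re := by
        simp
      rw [e, mul_left_comm, hd' x]
      have e2 : conj (Z s x) * (conj s * (κ * Complex.exp (Complex.I * x) * conj (Z s x) - Z s x)) =
          conj s * κ * Complex.exp (Complex.I * x) * conj (Z s x) ^ 2 -
            conj s * (Z s x * conj (Z s x)) := by ring
      rw [e2, Complex.mul_conj, Complex.sub_re, Complex.normSq_eq_norm_sq, Complex.re_mul_ofReal]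
      simp [ha]
    linear_combination (2 * x ^ (2 * a - 1)) * h3
  have hQder : ∀ x, X ≤ x → HasDerivAt Q ((x ^ (2 * a - 1) : ℝ) * (conj s * κ *
      Complex.exp (Complex.I * x) * conj (Z s x) ^ 2) + R x) x := by
    intro x hx
    have hx0 : 0 < x := by linarith
    have h1 : HasDerivAt (fun y : ℝ => Complex.exp (Complex.I * (y : ℂ)))
        (Complex.exp (Complex.I * x) * Complex.I) x := by
      have : HasDerivAt (fun y : ℝ => Complex.I * (y : ℂ)) Complex.I x := by
        simpa using (Complex.ofRealCLM.hasDerivAt (x := x)).const_mul Complex.I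
      exact this.cexp
    have h2 : HasDerivAt (fun y : ℝ => conj (Z s y)) (conj (d x)) x :=
      (Complex.conjCLE.toContinuousLinearMap.hasFDerivAt.comp_hasDerivAt x (hd x))
    have h3 := (Real.hasDerivAt_rpow_const (p := 2 * a - 1) (Or.inl hx0.ne')).ofReal_comp
    have h4 := ((h1.const_mul (conj s * κ / Complex.I)).mul (h2.pow 2)).mul h3
    refine h4.congr_deriv ?_
    simp only [hR]
    rw [hrp2 x hx0, show 2 * a - 1 - 1 = 2 * a - 2 by ring]
    push_cast
    simp only [Pi.mul_apply, Pi.pow_apply, pow_one]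
    field_simp
    ring
  set C : ℝ := 2 * (‖s‖ * (4 * ‖s‖ + |2 * a - 1|)) with hC
  have hC0 : 0 ≤ C := by positivity
  have hRle : ∀ x, X ≤ x → 2 * ‖R x‖ ≤ C / x ^ 2 * v x := by
    intro x hx
    have hx0 : 0 < x := by linarith
    have h1 : ‖(x : ℂ) * conj (d x)‖ ≤ 2 * ‖s‖ * ‖Z s x‖ := by
      rw [norm_mul, Complex.norm_conj, ← norm_mul, hd' x, norm_mul, Complex.norm_conj]
      have : ‖κ * Complex.exp (Complex.I * x) * conj (Z s x) - Z s x‖ ≤ ‖Z s x‖ + ‖Z s x‖ := by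
        refine (norm_sub_le _ _).trans ?_
        rw [norm_mul, norm_mul, hκ1, hexp, Complex.norm_conj]
        simp
      nlinarith [norm_nonneg s]
    have h2 : ‖2 * conj (Z s x) * (x * conj (d x)) + (2 * a - 1 : ℝ) * conj (Z s x) ^ 2‖ ≤
        (4 * ‖s‖ + |2 * a - 1|) * ‖Z s x‖ ^ 2 := by
      refine (norm_add_le _ _).trans ?_
      rw [norm_mul (2 * _), norm_mul (2 : ℂ), norm_mul ((2 * a - 1 : ℝ) : ℂ), norm_pow,
        Complex.norm_conj, Complex.norm_real, Real.norm_eq_abs]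
      have : ‖(2 : ℂ)‖ * ‖Z s x‖ * ‖(x : ℂ) * conj (d x)‖ ≤ 2 * ‖Z s x‖ * (2 * ‖s‖ * ‖Z s x‖) := by
        rw [Complex.norm_ofNat]
        gcongr
      rw [add_mul]
      linarith
    have e : ‖R x‖ = ‖s‖ * ‖2 * conj (Z s x) * (x * conj (d x)) +
        (2 * a - 1 : ℝ) * conj (Z s x) ^ 2‖ * x ^ (2 * a - 2) := by
      simp only [hR]
      rw [norm_mul, norm_mul, norm_mul, norm_div, norm_mul, hκ1, hexp, Complex.norm_conj,
        Complex.norm_I, Complex.norm_real, Real.norm_of_nonneg (Real.rpow_nonneg hx0.le _)]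
      ring
    have e2 : C / x ^ 2 * v x =
        2 * (‖s‖ * ((4 * ‖s‖ + |2 * a - 1|) * ‖Z s x‖ ^ 2) * x ^ (2 * a - 2)) := by
      simp only [hv, hC]
      rw [hrp1 x hx0, hrp2 x hx0]
      field_simp
    rw [e, e2]
    gcongr
  have hQle : ∀ x, X ≤ x → 2 * (Q x).re ≤ v x / 2 := by
    intro x hx
    have hx0 : 0 < x := by linarith
    have e : ‖Q x‖ = ‖s‖ * ‖Z s x‖ ^ 2 * x ^ (2 * a - 1) := by
      simp only [hQ]
      rw [norm_mul, norm_mul, norm_mul, norm_div, norm_mul, norm_pow, hκ1, hexp, Complex.norm_conj,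
        Complex.norm_I, Complex.norm_conj, Complex.norm_real,
        Real.norm_of_nonneg (Real.rpow_nonneg hx0.le _)]
      ring
    have h1 : 2 * (Q x).re ≤ 2 * ‖Q x‖ := by linarith [Complex.re_le_norm (Q x)]
    refine h1.trans ?_
    rw [e]
    simp only [hv]
    rw [hrp1 x hx0]
    have h3 : 4 * ‖s‖ ≤ x := by linarith
    have h4 : 0 ≤ x ^ (2 * a - 1) * ‖Z s x‖ ^ 2 :=
      mul_nonneg (Real.rpow_nonneg hx0.le _) (sq_nonneg _)
    nlinarith
  set G : ℝ → ℝ := fun x => v x - 2 * (Q x).re with hG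
  have hGv : ∀ x, X ≤ x → v x ≤ 2 * G x := fun x hx => by
    have := hQle x hx
    simp only [hG]
    linarith
  have hv0 : ∀ x, X ≤ x → 0 ≤ v x := fun x hx =>
    mul_nonneg (Real.rpow_nonneg (by linarith) _) (sq_nonneg _)
  have hGder : ∀ x, X ≤ x → HasDerivAt G (-(2 * (R x).re)) x := by
    intro x hx
    have h1 := (Complex.reCLM.hasFDerivAt.comp_hasDerivAt x (hQder x hx)).const_mul 2
    refine ((hvder x hx).sub h1).congr_deriv ?_
    simp only [hv', Complex.reCLM_apply, Complex.add_re, Complex.re_ofReal_mul]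
    ring
  refine ⟨X, 2 * (G X * Real.exp ((2 * C) / X)), hX1, fun x hx => ?_⟩
  have := bounded_of_deriv_le_div_sq (G := G) (G' := fun x => -(2 * (R x).re)) (X := X) (C := 2 * C)
    (by linarith) hGder (fun x hx => by linarith [hGv x hx, hv0 x hx]) (by positivity)
    (fun x hx => ?_) hx
  · exact (hGv x hx).trans (by linarith)
  · have h1 : -(2 * (R x).re) ≤ 2 * ‖R x‖ := by
      have := (abs_le.1 (Complex.abs_re_le_norm (R x))).1
      linarith
    refine h1.trans ((hRle x hx).trans ?_)
    have hx0 : 0 < x := by linarith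
    calc C / x ^ 2 * v x ≤ C / x ^ 2 * (2 * G x) := by
          gcongr
          exact hGv x hx
      _ = _ := by ring

theorem exists_rpow_mul_norm_Z_le {s : ℂ} (hs : -(1 / 2 : ℝ) < s.re) :
    ∃ B : ℝ, 0 ≤ B ∧ ∀ x : ℝ, 1 ≤ x → x ^ s.re * ‖Z s x‖ ≤ B := by
  obtain ⟨X, B, hX, hB⟩ := exists_rpow_mul_norm_Z_le_of_large hs
  have hcont : ContinuousOn (fun x : ℝ => x ^ s.re * ‖Z s x‖) (Set.Icc 1 X) := by
    refine ContinuousOn.mul (fun x hx => ?_) (continuous_Z hs).norm.continuousOn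
    exact (Real.continuousAt_rpow_const x _ (Or.inl (by linarith [hx.1]))).continuousWithinAt
  obtain ⟨B', hB'⟩ := isCompact_Icc.exists_bound_of_continuousOn hcont
  refine ⟨max (Real.sqrt B) |B'|, le_max_of_le_right (abs_nonneg _), fun x hx => ?_⟩
  rcases le_total x X with h | h
  · exact le_max_of_le_right ((le_abs_self _).trans
      ((Real.norm_eq_abs _ ▸ hB' x ⟨hx, h⟩).trans (le_abs_self _)))
  · refine le_max_of_le_left (Real.le_sqrt_of_sq_le ?_)
    rw [mul_pow, ← Real.rpow_natCast, ← Real.rpow_mul (by linarith)]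
    have := hB x h
    rwa [mul_comm (2 : ℝ)] at this

/-- Negative x are reduced to positive ones by Z_s(-x) = conj(Z_{s̄}(x)). -/
theorem exists_rpow_abs_mul_norm_Z_le {s : ℂ} (hs : -(1 / 2 : ℝ) < s.re) :
    ∃ B : ℝ, 0 ≤ B ∧ ∀ x : ℝ, 1 ≤ |x| → |x| ^ s.re * ‖Z s x‖ ≤ B := by
  obtain ⟨B, hB0, hB⟩ := exists_rpow_mul_norm_Z_le hs
  have hs' : -(1 / 2 : ℝ) < (conj s).re := by simpa using hs
  obtain ⟨B', -, hB'⟩ := exists_rpow_mul_norm_Z_le hs'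
  refine ⟨max B B', le_max_of_le_left hB0, fun x hx => ?_⟩
  rcases le_total 0 x with h | h
  · rw [abs_of_nonneg h] at hx ⊢
    exact le_max_of_le_left (hB x hx)
  · rw [abs_of_nonpos h] at hx ⊢
    have := hB' (-x) hx
    rw [Z_neg, Complex.norm_conj] at *
    refine le_max_of_le_right ?_
    have h2 := Z_neg s (-x)
    rw [neg_neg] at h2
    rw [h2, Complex.norm_conj]
    simpa using hB' (-x) hx

/-! ### The functions `psi`, `rho` and `genExp` -/

theorem norm_psi_le (s : ℂ) (x : ℝ) : ‖psi s x‖ ≤ 1 := by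
  unfold psi
  rw [norm_mul, Complex.norm_exp]
  have h1 : (-(Complex.I * (Real.pi : ℂ) / 2) * (s.re : ℂ) * (Real.sign x : ℂ)).re = 0 := by simp
  rw [h1, Real.exp_zero, one_mul]
  rcases eq_or_ne x 0 with rfl | hx
  · rw [abs_zero, Complex.ofReal_zero]
    by_cases h : -(Complex.I * (s.im : ℂ)) = 0
    · rw [h]; simp
    · rw [Complex.zero_cpow h]; simp
  · rw [Complex.norm_cpow_eq_rpow_re_of_pos (abs_pos.mpr hx)]
    simp

theorem norm_psi {s : ℂ} {x : ℝ} (hx : x ≠ 0) : ‖psi s x‖ = 1 := by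
  unfold psi
  rw [norm_mul, Complex.norm_exp]
  have h1 : (-(Complex.I * (Real.pi : ℂ) / 2) * (s.re : ℂ) * (Real.sign x : ℂ)).re = 0 := by simp
  rw [h1, Real.exp_zero, one_mul, Complex.norm_cpow_eq_rpow_re_of_pos (abs_pos.mpr hx)]
  simp

theorem rho_nonneg (s : ℂ) (x : ℝ) : 0 ≤ rho s x :=
  mul_nonneg (Real.rpow_nonneg (abs_nonneg _) _) (Real.exp_pos _).le

theorem abs_sign_le_one (x : ℝ) : |Real.sign x| ≤ 1 := by
  rcases Real.sign_apply_eq x with h | h | h <;> simp [h]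

theorem rho_le (s : ℂ) (x : ℝ) : rho s x ≤ |x| ^ s.re * Real.exp (Real.pi / 2 * |s.im|) := by
  unfold rho
  refine mul_le_mul_of_nonneg_left (Real.exp_le_exp.2 ?_) (Real.rpow_nonneg (abs_nonneg _) _)
  calc -(Real.pi / 2) * s.im * Real.sign x ≤ |-(Real.pi / 2) * s.im * Real.sign x| := le_abs_self _
    _ = Real.pi / 2 * |s.im| * |Real.sign x| := by
      rw [abs_mul, abs_mul, abs_neg, abs_of_pos (by positivity : 0 < Real.pi / 2)]
    _ ≤ Real.pi / 2 * |s.im| * 1 := by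
      gcongr
      exact abs_sign_le_one x
    _ = _ := mul_one _

theorem norm_genExp_le (s : ℂ) (x : ℝ) : ‖genExp s x‖ ≤ rho s x * ‖Z s x‖ := by
  unfold genExp
  rw [norm_mul, norm_mul, norm_mul, norm_div, Complex.norm_conj, Complex.norm_real,
    Complex.norm_real, Real.norm_of_nonneg (rho_nonneg s x),
      Real.norm_of_nonneg (Real.sqrt_nonneg _),
    ← mul_neg, mul_comm Complex.I, ← Complex.ofReal_neg, Complex.norm_exp_ofReal_mul_I]
  have h1 : 1 / Real.sqrt (2 * Real.pi) ≤ 1 := by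
    rw [div_le_one (by positivity)]
    exact Real.one_le_sqrt.2 (by linarith [Real.pi_gt_three])
  have h2 := norm_psi_le s x
  calc _ ≤ 1 * rho s x * 1 * ‖Z s x‖ := by
        gcongr
        exact mul_nonneg zero_le_one (rho_nonneg s x)
        exact rho_nonneg s x
    _ = _ := by ring

/-- Near 0 the function `Z` is bounded and only |x|^{Re s} can be singular; for |x| ≥ 1 the decay of
`Z` compensates `rho`. -/
theorem exists_norm_genExp_le {s : ℂ} (hs : -(1 / 2 : ℝ) < s.re) :
    ∃ C : ℝ, 0 ≤ C ∧ ∀ x : ℝ, ‖genExp s x‖ ≤ C * (1 + |x| ^ (min s.re 0)) := by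
  obtain ⟨B, hB0, hB⟩ := exists_rpow_abs_mul_norm_Z_le hs
  obtain ⟨B', hB'⟩ := (isCompact_Icc (a := (-1 : ℝ)) (b := 1)).exists_bound_of_continuousOn
    (continuous_Z hs).continuousOn
  have hB'0 : 0 ≤ B' := (norm_nonneg _).trans (hB' 0 (by simp))
  set E := Real.exp (Real.pi / 2 * |s.im|) with hE
  have hE0 : 0 < E := Real.exp_pos _
  refine ⟨E * (B + B'), by positivity, fun x => (norm_genExp_le s x).trans ?_⟩
  have hm : 0 ≤ |x| ^ (min s.re 0) := Real.rpow_nonneg (abs_nonneg _) _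
  have h1 : rho s x * ‖Z s x‖ ≤ E * (|x| ^ s.re * ‖Z s x‖) := by
    calc _ ≤ (|x| ^ s.re * E) * ‖Z s x‖ := by
          gcongr
          exact rho_le s x
      _ = _ := by ring
  refine h1.trans ?_
  rw [mul_assoc]
  refine mul_le_mul_of_nonneg_left ?_ hE0.le
  rcases le_total 1 |x| with h | h
  · nlinarith [hB x h]
  · have h2 := hB' x (abs_le.1 h)
    have h3 : |x| ^ s.re ≤ 1 + |x| ^ (min s.re 0) := by
      rcases le_total 0 s.re with h4 | h4
      · linarith [Real.rpow_le_one (abs_nonneg x) h h4]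
      · rw [min_eq_left h4]; linarith
    calc _ ≤ (1 + |x| ^ (min s.re 0)) * B' := by gcongr
      _ ≤ _ := by nlinarith

/-! ### The relation between the kernels -/

/-- The integrand `e^{i(x-y)t} conj(Z(xt)) Z(yt)`. -/
def zProd (s : ℂ) (x y t : ℝ) : ℂ :=
  Complex.exp (Complex.I * ((x : ℂ) - y) * t) * conj (Z s (x * t)) * Z s (y * t)

theorem continuous_zProd {s : ℂ} (hs : -(1 / 2 : ℝ) < s.re) (x : ℝ) :
    Continuous fun p : ℝ × ℝ => zProd s x p.1 p.2 := by
  unfold zProd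
  have hZ := continuous_Z hs
  fun_prop

/-- After the differential equation is inserted, the terms with κ and with its conjugate cancel in
pairs. The rest is -(s + s̄) times the numerator, plus the derivative of the exponential. Thus t^{2
Re s} is the right factor to make the numerator an antiderivative. -/
theorem exists_hasDerivAt_kernelNum {s : ℂ} (hs : -(1 / 2 : ℝ) < s.re) (x y t : ℝ) :
    ∃ d : ℂ, HasDerivAt (fun t : ℝ => kernelNum s (x * t) (y * t)) d t ∧
      t * d + 2 * s.re * kernelNum s (x * t) (y * t) =
        t * (Complex.I * ((y : ℂ) - x)) * zProd s x y t := by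
  choose d hd hd' using exists_hasDerivAt_Z hs
  have hZx : ∀ x : ℝ, HasDerivAt (fun t : ℝ => Z s (x * t)) (x * d (x * t)) t := by
    intro x
    have h1 : HasDerivAt (fun t : ℝ => x * t) x t := by simpa using (hasDerivAt_id t).const_mul x
    exact (HasDerivAt.scomp (g₁ := Z s) (h := fun t : ℝ => x * t) t (hd (x * t)) h1).congr_deriv
      (by simp)
  have hconj : ∀ x : ℝ, HasDerivAt (fun t : ℝ => conj (Z s (x * t))) (conj (x * d (x * t))) t :=
    fun x => Complex.conjCLE.toContinuousLinearMap.hasFDerivAt.comp_hasDerivAt t (hZx x)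
  have hexp : HasDerivAt (fun t : ℝ => Complex.exp (Complex.I * (((x * t : ℝ) : ℂ) - (y * t : ℝ))))
      (Complex.exp (Complex.I * (((x * t : ℝ) : ℂ) - (y * t : ℝ))) *
        (Complex.I * ((x : ℂ) - y))) t := by
    have h2 : HasDerivAt (fun t : ℝ => Complex.I * (((x * t : ℝ) : ℂ) - (y * t : ℝ)))
        (Complex.I * ((x : ℂ) - y)) t := by
      have := ((Complex.ofRealCLM.hasDerivAt (x := t)).const_mul ((x : ℂ) - y)).const_mul Complex.I
      refine (this.congr_deriv (by simp)).congr_of_eventuallyEq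
        (Filter.Eventually.of_forall fun t => ?_)
      simp
      ring
    exact h2.cexp
  have hD := ((hZx x).fun_mul (hconj y)).fun_sub ((hexp.fun_mul (hconj x)).fun_mul (hZx y))
  refine ⟨_, hD, ?_⟩
  have hx := hd' (x * t)
  have hy := hd' (y * t)
  have hxc := congrArg conj hx
  have hyc := congrArg conj hy
  have ex : Complex.exp (Complex.I * (((x * t : ℝ) : ℂ) - (y * t : ℝ))) =
      Complex.exp (Complex.I * (x * t : ℝ)) * Complex.exp (-(Complex.I * (y * t : ℝ))) := by
    rw [← Complex.exp_add]; congr 1; ring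
  have ex' : Complex.exp (Complex.I * ((x : ℂ) - y) * t) =
      Complex.exp (Complex.I * (x * t : ℝ)) * Complex.exp (-(Complex.I * (y * t : ℝ))) := by
    rw [← Complex.exp_add]; congr 1; push_cast; ring
  have hcc : ∀ z : ℝ, conj (Complex.exp (Complex.I * z)) = Complex.exp (-(Complex.I * z)) := by
    intro z
    rw [← Complex.exp_conj]
    simp
  have hinv : ∀ z : ℝ, Complex.exp (Complex.I * z) * Complex.exp (-(Complex.I * z)) = 1 := by
    intro z
    rw [← Complex.exp_add]; simp
  have hix := hinv (x * t)
  have hiy := hinv (y * t)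
  have hre : (2 : ℂ) * s.re = s + conj s := by
    have := Complex.add_conj s
    push_cast at this
    exact this.symm
  simp only [kernelNum, zProd]
  rw [hre, ex, ex']
  simp only [map_mul, map_sub, Complex.conj_conj, Complex.conj_ofReal, hcc] at hxc hyc ⊢
  push_cast at *
  set κ := zConst s / conj (zConst s)
  set Ex := Complex.exp (Complex.I * (x * t))
  set Ex' := Complex.exp (-(Complex.I * (x * t)))
  set Ey := Complex.exp (Complex.I * (y * t))
  set Ey' := Complex.exp (-(Complex.I * (y * t)))
  set Zx := Z s (x * t)
  set Zy := Z s (y * t)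
  linear_combination conj Zy * hx + Zx * hyc - Ex * Ey' * Zy * hxc - Ex * Ey' * conj Zx * hy -
    s * conj κ * Ey' * Zx * Zy * hix - conj s * κ * Ex * conj Zx * conj Zy * hiy

theorem kernelNum_zero (s : ℂ) : kernelNum s 0 0 = 0 := by
  simp [kernelNum, mul_comm]

theorem intervalIntegrable_rpow_mul_zProd {s : ℂ} (hs : -(1 / 2 : ℝ) < s.re) (x y : ℝ) :
    IntervalIntegrable (fun t : ℝ => ((t ^ (2 * s.re) : ℝ) : ℂ) * zProd s x y t) volume 0 1 := by
  have h : IntervalIntegrable (fun t : ℝ => t ^ (2 * s.re)) volume 0 1 :=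
    intervalIntegral.intervalIntegrable_rpow' (by linarith)
  have hZ := continuous_Z hs
  have hc : Continuous fun t : ℝ => zProd s x y t := by
    unfold zProd
    fun_prop
  rw [intervalIntegrable_iff] at h ⊢
  have h1 : IntegrableOn (fun t : ℝ => ((t ^ (2 * s.re) : ℝ) : ℂ)) (Set.uIoc 0 1) := h.ofReal
  rw [← intervalIntegrable_iff] at h1 ⊢
  exact h1.mul_continuousOn hc.continuousOn

theorem mul_integral_rpow_mul_zProd {s : ℂ} (hs : -(1 / 2 : ℝ) < s.re) (x y : ℝ) :
    Complex.I * ((y : ℂ) - x) * ∫ t in (0 : ℝ)..1, ((t ^ (2 * s.re) : ℝ) : ℂ) * zProd s x y t =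
      kernelNum s x y := by
  choose d hd hd' using exists_hasDerivAt_kernelNum hs x y
  have hder : ∀ t ∈ Set.Ioo (0 : ℝ) 1,
      HasDerivAt (fun t : ℝ => ((t ^ (2 * s.re) : ℝ) : ℂ) * kernelNum s (x * t) (y * t))
        (Complex.I * ((y : ℂ) - x) * (((t ^ (2 * s.re) : ℝ) : ℂ) * zProd s x y t)) t := by
    intro t ht
    have ht0 : t ≠ 0 := ht.1.ne'
    have h1 := (Real.hasDerivAt_rpow_const (p := 2 * s.re) (Or.inl ht0)).ofReal_comp
    refine (h1.fun_mul (hd t)).congr_deriv ?_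
    have h2 : t ^ (2 * s.re) = t ^ (2 * s.re - 1) * t := by
      rw [← Real.rpow_add_one ht0]; congr 1; ring
    rw [h2]
    push_cast
    linear_combination ((t ^ (2 * s.re - 1) : ℝ) : ℂ) * hd' t
  -- The numerator vanishes at t = 0 to first order, and 2 Re s + 1 > 0, so the lower boundary term
  -- is zero even when t^{2 Re s} blows up.
  have hlim0 : Filter.Tendsto
      (fun t : ℝ => ((t ^ (2 * s.re) : ℝ) : ℂ) * kernelNum s (x * t) (y * t))
      (nhdsWithin 0 (Set.Ioi 0)) (nhds 0) := by
    have h1 : Filter.Tendsto (slope (fun t : ℝ => kernelNum s (x * t) (y * t)) 0)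
        (nhdsWithin 0 (Set.Ioi 0)) (nhds (d 0)) :=
      (hasDerivAt_iff_tendsto_slope.1 (hd 0)).mono_left
        (nhdsWithin_mono _ fun t ht => (ne_of_gt ht : t ≠ 0))
    have h2 : Filter.Tendsto (fun t : ℝ => ((t ^ (2 * s.re + 1) : ℝ) : ℂ))
        (nhdsWithin 0 (Set.Ioi 0)) (nhds 0) := by
      have h3 : ContinuousAt (fun t : ℝ => t ^ (2 * s.re + 1)) 0 :=
        Real.continuousAt_rpow_const _ _ (Or.inr (by linarith))
      have h4 : Filter.Tendsto (fun t : ℝ => ((t ^ (2 * s.re + 1) : ℝ) : ℂ)) (nhds 0)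
          (nhds (((0 : ℝ) ^ (2 * s.re + 1) : ℝ) : ℂ)) :=
        (Complex.continuous_ofReal.tendsto _).comp h3
      rw [Real.zero_rpow (by linarith), Complex.ofReal_zero] at h4
      exact h4.mono_left nhdsWithin_le_nhds
    have h5 := h2.mul h1
    rw [zero_mul] at h5
    refine h5.congr' ?_
    filter_upwards [self_mem_nhdsWithin] with t ht
    have ht0 : t ≠ 0 := ne_of_gt ht
    have ht0' : (t : ℂ) ≠ 0 := by exact_mod_cast ht0
    rw [slope_def_module, Real.rpow_add_one ht0]
    simp only [mul_zero, kernelNum_zero, sub_zero, Complex.real_smul]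
    push_cast
    field_simp
  have hlim1 : Filter.Tendsto
      (fun t : ℝ => ((t ^ (2 * s.re) : ℝ) : ℂ) * kernelNum s (x * t) (y * t))
      (nhdsWithin 1 (Set.Iio 1)) (nhds (kernelNum s x y)) := by
    have h1 : ContinuousAt (fun t : ℝ => ((t ^ (2 * s.re) : ℝ) : ℂ)) 1 :=
      Complex.continuous_ofReal.continuousAt.comp
        (Real.continuousAt_rpow_const _ _ (Or.inl one_ne_zero))
    have h2 := (h1.mul (hd 1).continuousAt).tendsto
    simp only [Pi.mul_apply, Real.one_rpow, Complex.ofReal_one, one_mul, mul_one] at h2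
    exact h2.mono_left nhdsWithin_le_nhds
  have := intervalIntegral.integral_eq_sub_of_hasDerivAt_of_tendsto zero_lt_one hder
    ((intervalIntegrable_rpow_mul_zProd hs x y).const_mul _) hlim0 hlim1
  rw [intervalIntegral.integral_const_mul, sub_zero] at this
  exact this

theorem continuous_integral_rpow_mul_zProd {s : ℂ} (hs : -(1 / 2 : ℝ) < s.re) (x : ℝ) :
    Continuous fun y : ℝ => ∫ t in (0 : ℝ)..1, ((t ^ (2 * s.re) : ℝ) : ℂ) * zProd s x y t := by
  refine continuous_iff_continuousAt.2 fun y => ?_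
  obtain ⟨B, hB⟩ := ((isCompact_Icc (a := y - 1) (b := y + 1)).prod
    (isCompact_Icc (a := (0 : ℝ)) (b := 1))).exists_bound_of_continuousOn
    (continuous_zProd hs x).continuousOn
  refine intervalIntegral.continuousAt_of_dominated_interval
    (bound := fun t => t ^ (2 * s.re) * B) ?_ ?_ ?_ ?_
  · refine Filter.Eventually.of_forall fun u => ?_
    exact (intervalIntegrable_rpow_mul_zProd hs x u).def'.aestronglyMeasurable
  · filter_upwards [Icc_mem_nhds (sub_one_lt y) (lt_add_one y)] with u hu
    refine Filter.Eventually.of_forall fun t ht => ?_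
    rw [Set.uIoc_of_le zero_le_one] at ht
    rw [norm_mul, Complex.norm_real, Real.norm_of_nonneg (Real.rpow_nonneg ht.1.le _)]
    exact mul_le_mul_of_nonneg_left (hB (u, t) ⟨hu, ht.1.le, ht.2⟩) (Real.rpow_nonneg ht.1.le _)
  · exact (intervalIntegral.intervalIntegrable_rpow' (by linarith)).mul_const B
  · refine Filter.Eventually.of_forall fun t _ => ?_
    exact (continuous_const.mul ((continuous_zProd hs x).comp
      (by fun_prop : Continuous fun u : ℝ => ((u, t) : ℝ × ℝ)))).continuousAt

/-- The numerator is i(u - x) J(u) with J continuous, so its derivative at u = x is i J(x). Hence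
the formula found off the diagonal persists on it. -/
theorem kernel_eq_integral {s : ℂ} (hs : -(1 / 2 : ℝ) < s.re) (x y : ℝ) :
    kernel s x y = rho s x * rho s y / (2 * Real.pi) *
      ∫ t in (0 : ℝ)..1, ((t ^ (2 * s.re) : ℝ) : ℂ) * zProd s x y t := by
  have hpi : (Real.pi : ℂ) ≠ 0 := by exact_mod_cast Real.pi_ne_zero
  set J : ℝ → ℂ := fun y => ∫ t in (0 : ℝ)..1, ((t ^ (2 * s.re) : ℝ) : ℂ) * zProd s x y t with hJ
  have hnum : ∀ u : ℝ, kernelNum s x u = Complex.I * ((u : ℂ) - x) * J u := fun u =>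
    (mul_integral_rpow_mul_zProd hs x u).symm
  unfold kernel
  change _ = _ * J y
  split_ifs with h
  · subst h
    have hder : HasDerivAt (fun u : ℝ => kernelNum s x u) (Complex.I * J x) x := by
      rw [hasDerivAt_iff_tendsto_slope]
      have h1 : Filter.Tendsto (fun u : ℝ => Complex.I * J u) (nhdsWithin x {x}ᶜ)
          (nhds (Complex.I * J x)) :=
        (((continuous_integral_rpow_mul_zProd hs x).tendsto x).const_mul Complex.I).mono_left
          nhdsWithin_le_nhds
      refine h1.congr' ?_
      filter_upwards [self_mem_nhdsWithin] with u hu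
      have hu' : (u : ℂ) - x ≠ 0 := sub_ne_zero.2 (by exact_mod_cast hu)
      rw [slope_def_module, hnum, hnum, sub_self, mul_zero, zero_mul, sub_zero, Complex.real_smul]
      push_cast
      field_simp
    rw [hder.deriv]
    field_simp [Complex.I_ne_zero]
  · have hxy : (y : ℂ) - x ≠ 0 := sub_ne_zero.2 (by exact_mod_cast (Ne.symm h))
    rw [hnum]
    field_simp [Complex.I_ne_zero]

theorem sign_mul_of_pos (x : ℝ) {t : ℝ} (ht : 0 < t) : Real.sign (x * t) = Real.sign x := by
  rcases lt_trichotomy x 0 with h | rfl | h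
  · rw [Real.sign_of_neg h, Real.sign_of_neg (mul_neg_of_neg_of_pos h ht)]
  · simp
  · rw [Real.sign_of_pos h, Real.sign_of_pos (mul_pos h ht)]

theorem rho_mul_of_pos (s : ℂ) (x : ℝ) {t : ℝ} (ht : 0 < t) :
    rho s (x * t) = rho s x * t ^ s.re := by
  unfold rho
  rw [sign_mul_of_pos x ht, abs_mul, abs_of_pos ht, Real.mul_rpow (abs_nonneg _) ht.le]
  ring

theorem psi_mul_of_pos (s : ℂ) (x : ℝ) {t : ℝ} (ht : 0 < t) :
    psi s (x * t) = psi s x * (t : ℂ) ^ (-(Complex.I * (s.im : ℂ))) := by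
  unfold psi
  rw [sign_mul_of_pos x ht, abs_mul, abs_of_pos ht, Complex.ofReal_mul,
    Complex.mul_cpow_ofReal_nonneg (abs_nonneg _) ht.le]
  ring

/-- By homogeneity the two factors t^{Re s} combine to t^{2 Re s}, while the unimodular powers t^{±i
Im s} cancel. -/
theorem conj_genExp_mul_genExp {s : ℂ} (x y : ℝ) {t : ℝ} (ht : 0 < t) :
    conj (genExp s (x * t)) * genExp s (y * t) =
      psi s x * (rho s x * rho s y / (2 * Real.pi)) * conj (psi s y) *
        (((t ^ (2 * s.re) : ℝ) : ℂ) * zProd s x y t) := by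
  set w := (t : ℂ) ^ (-(Complex.I * (s.im : ℂ))) with hw
  have hw1 : w * conj w = 1 := by
    rw [Complex.mul_conj, Complex.normSq_eq_norm_sq, hw,
      Complex.norm_cpow_eq_rpow_re_of_pos ht]
    simp
  have hsq : ((Real.sqrt (2 * Real.pi) : ℝ) : ℂ) * (Real.sqrt (2 * Real.pi) : ℝ) = 2 * Real.pi := by
    rw [← Complex.ofReal_mul, Real.mul_self_sqrt (by positivity)]
    push_cast; ring
  have hsq0 : ((Real.sqrt (2 * Real.pi) : ℝ) : ℂ) ≠ 0 := by
    exact_mod_cast (Real.sqrt_pos.2 (by positivity)).ne'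
  have hexp : conj (Complex.exp (-(Complex.I * ((x * t : ℝ) : ℂ)))) *
      Complex.exp (-(Complex.I * ((y * t : ℝ) : ℂ))) =
      Complex.exp (Complex.I * ((x : ℂ) - y) * t) := by
    rw [← Complex.exp_conj, ← Complex.exp_add]
    congr 1
    simp
    ring
  have ht2 : ((t ^ (2 * s.re) : ℝ) : ℂ) = ((t ^ s.re : ℝ) : ℂ) * (t ^ s.re : ℝ) := by
    rw [← Complex.ofReal_mul, ← Real.rpow_add ht]; congr 2; ring
  unfold genExp zProd
  rw [rho_mul_of_pos s x ht, rho_mul_of_pos s y ht, psi_mul_of_pos s x ht, psi_mul_of_pos s y ht,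
    ← hw, ht2, ← hexp, ← hsq]
  generalize Z s (x * t) = zx
  generalize Z s (y * t) = zy
  generalize Complex.exp (-(Complex.I * ((x * t : ℝ) : ℂ))) = ex
  generalize Complex.exp (-(Complex.I * ((y * t : ℝ) : ℂ))) = ey
  simp only [map_mul, map_div₀, Complex.conj_conj, Complex.conj_ofReal, Complex.ofReal_mul]
  generalize ((Real.sqrt (2 * Real.pi) : ℝ) : ℂ) = q at hsq0
  rw [← sub_eq_zero]
  field_simp
  linear_combination (conj ex * ey * rho s x * ((t ^ s.re : ℝ) : ℂ) ^ 2 * psi s x * conj zx *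
    rho s y * conj (psi s y) * zy) * hw1

theorem intervalIntegrable_conj_genExp_mul_genExp {s : ℂ} (hs : -(1 / 2 : ℝ) < s.re) (x y : ℝ) :
    IntervalIntegrable (fun t : ℝ => conj (genExp s (x * t)) * genExp s (y * t)) volume 0 1 := by
  refine ((intervalIntegrable_rpow_mul_zProd hs x y).const_mul
    (psi s x * (rho s x * rho s y / (2 * Real.pi)) * conj (psi s y))).congr fun t ht => ?_
  rw [Set.uIoc_of_le zero_le_one] at ht
  exact (conj_genExp_mul_genExp x y ht.1).symm

theorem integral_conj_genExp_mul_genExp {s : ℂ} (hs : -(1 / 2 : ℝ) < s.re) (x y : ℝ) :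
    ∫ t in (0 : ℝ)..1, conj (genExp s (x * t)) * genExp s (y * t) =
      psi s x * kernel s x y * conj (psi s y) := by
  rw [kernel_eq_integral hs, intervalIntegral.integral_congr_ae (g := fun t =>
    psi s x * (rho s x * rho s y / (2 * Real.pi)) * conj (psi s y) *
      (((t ^ (2 * s.re) : ℝ) : ℂ) * zProd s x y t)), intervalIntegral.integral_const_mul]
  · ring
  · refine Filter.Eventually.of_forall fun t ht => ?_
    rw [Set.uIoc_of_le zero_le_one] at ht
    exact conj_genExp_mul_genExp x y ht.1

/-! ### The case `s = 0` -/

theorem genExp_zero (x : ℝ) :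
    genExp 0 x = Complex.exp (-(Complex.I * (x : ℂ))) / (Real.sqrt (2 * Real.pi) : ℂ) := by
  have h1 : hyp1F1 0 1 (Complex.I * x) = 1 := by
    rw [hyp1F1_eq, tsum_eq_single 0]
    · simp [hypCoeff]
    · intro k hk
      obtain ⟨k, rfl⟩ := Nat.exists_eq_succ_of_ne_zero hk
      rw [hypCoeff, Nat.succ_eq_add_one, ascPochhammer_succ_eval_left]
      simp
  simp [genExp, rho, psi, Z, h1]

theorem transform_zero (f : ℝ → ℂ) (ω : ℝ) : transform 0 f ω = fourier f ω := by
  unfold transform fourier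
  rw [← integral_const_mul]
  refine integral_congr_ae (Filter.Eventually.of_forall fun x => ?_)
  simp only [genExp_zero]
  push_cast
  rw [mul_assoc]
  ring

/-! ### Laplace transforms -/

/-- The binomial series of (1 + w)^{-α} at w = -z; the signs in the binomial coefficient of -α and
in (-z)^k cancel to (α)_k / k!. -/
theorem hasSum_binomial (α : ℂ) {z : ℂ} (hz : ‖z‖ < 1) :
    HasSum (fun k : ℕ => (ascPochhammer ℂ k).eval α / (k.factorial : ℂ) * z ^ k)
      ((1 - z) ^ (-α)) := by
  have hmem : -z ∈ Metric.eball (0 : ℂ) 1 := by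
    rw [← ENNReal.ofReal_one, Metric.eball_ofReal]
    simpa using hz
  have h := (Complex.one_add_cpow_hasFPowerSeriesOnBall_zero (a := -α)).hasSum hmem
  rw [zero_add, ← sub_eq_add_neg] at h
  refine h.congr_fun fun k => ?_
  have h1 := ascPochhammer_eval_neg_eq_descPochhammer (R := ℂ) (-α) k
  rw [neg_neg] at h1
  simp only [binomialSeries_apply, Ring.choose_eq_smul,
    Polynomial.descPochhammer_smeval_eq_ascPochhammer, Polynomial.ascPochhammer_smeval_cast,
    Polynomial.ascPochhammer_smeval_eq_eval, ← descPochhammer_eval_eq_ascPochhammer]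
  rw [h1]
  simp only [List.ofFn_const, List.prod_replicate, smul_eq_mul]
  rw [neg_pow]
  ring

theorem mul_cpow_of_arg_add_mem {x y : ℂ} (hx : x ≠ 0) (hy : y ≠ 0)
    (h : x.arg + y.arg ∈ Set.Ioc (-Real.pi) Real.pi) (r : ℂ) : (x * y) ^ r = x ^ r * y ^ r := by
  rw [Complex.cpow_def_of_ne_zero (mul_ne_zero hx hy), Complex.cpow_def_of_ne_zero hx,
    Complex.cpow_def_of_ne_zero hy, Complex.log_mul hx hy h, ← Complex.exp_add, add_mul]

theorem differentiableOn_laplace {h : ℝ → ℂ}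
    (hm : AEStronglyMeasurable h (volume.restrict (Set.Ioi 0)))
    (hi : ∀ ε : ℝ, 0 < ε → IntegrableOn (fun x : ℝ => Real.exp (-ε * x) * ‖h x‖) (Set.Ioi 0)) :
    DifferentiableOn ℂ (fun p : ℂ => ∫ x in Set.Ioi (0 : ℝ), Complex.exp (-p * x) * h x)
      {p : ℂ | 0 < p.re} := by
  intro p hp
  have hp : 0 < p.re := hp
  -- On the ball of radius 2δ one has Re q ≥ 2δ. One δ pays for the factor x, through x ≤ δ⁻¹
  -- e^{δx}, and the other keeps the bound integrable.
  set δ := p.re / 4 with hδ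
  have hδ0 : 0 < δ := by positivity
  have hexpm : ∀ q : ℂ, AEStronglyMeasurable (fun x : ℝ => Complex.exp (-q * x))
      (volume.restrict (Set.Ioi 0)) := fun q => by
    have : Continuous fun x : ℝ => Complex.exp (-q * x) := by fun_prop
    exact this.aestronglyMeasurable
  have hnexp : ∀ (q : ℂ) (x : ℝ), ‖Complex.exp (-q * x)‖ = Real.exp (-q.re * x) := fun q x => by
    rw [Complex.norm_exp]; simp
  have hint : ∀ q : ℂ, 0 < q.re →
      Integrable (fun x : ℝ => Complex.exp (-q * x) * h x) (volume.restrict (Set.Ioi 0)) := by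
    intro q hq
    refine (hi q.re hq).mono' ((hexpm q).mul hm) (Filter.Eventually.of_forall fun x => ?_)
    rw [norm_mul, hnexp]
  refine (hasDerivAt_integral_of_dominated_loc_of_deriv_le (𝕜 := ℂ)
    (s := Metric.ball p (2 * δ)) (bound := fun x => δ⁻¹ * (Real.exp (-δ * x) * ‖h x‖))
    (F' := fun q x => -x * Complex.exp (-q * x) * h x)
    (Metric.ball_mem_nhds p (by positivity)) (Filter.Eventually.of_forall fun q => (hexpm q).mul hm)
    (hint p hp) ?_ ?_ ((hi δ hδ0).const_mul _) ?_).2.differentiableAt.differentiableWithinAt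
  · refine AEStronglyMeasurable.mul (AEStronglyMeasurable.mul ?_ (hexpm p)) hm
    exact (by fun_prop : Continuous fun x : ℝ => -(x : ℂ)).aestronglyMeasurable
  · refine (ae_restrict_iff' measurableSet_Ioi).2 (Filter.Eventually.of_forall fun x hx q hq => ?_)
    have hx : 0 < x := hx
    have hq' : 2 * δ ≤ q.re := by
      have h1 : ‖q - p‖ < 2 * δ := by simpa [dist_eq_norm] using hq
      have h2 := (abs_le.1 (Complex.abs_re_le_norm (q - p))).1
      rw [Complex.sub_re] at h2
      have : p.re = 4 * δ := by rw [hδ]; ring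
      linarith
    rw [norm_mul, norm_mul, norm_neg, Complex.norm_real, Real.norm_of_nonneg hx.le, hnexp,
      ← mul_assoc]
    refine mul_le_mul_of_nonneg_right ?_ (norm_nonneg _)
    have h3 : x ≤ δ⁻¹ * Real.exp (δ * x) := by
      rw [le_inv_mul_iff₀ hδ0]
      linarith [Real.add_one_le_exp (δ * x)]
    calc x * Real.exp (-q.re * x) ≤ (δ⁻¹ * Real.exp (δ * x)) * Real.exp (-(2 * δ) * x) :=
          mul_le_mul h3 (Real.exp_le_exp.2 (by nlinarith)) (Real.exp_pos _).le (by positivity)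
      _ = _ := by
          rw [mul_assoc, ← Real.exp_add]; congr 2; ring
  · refine Filter.Eventually.of_forall fun x q _ => ?_
    have h1 : HasDerivAt (fun q : ℂ => -q * x) (-x : ℂ) q := by
      simpa using ((hasDerivAt_id q).neg).mul_const (x : ℂ)
    refine (h1.cexp.mul_const (h x)).congr_deriv ?_
    ring

/-- The identity theorem on the right half-plane: the real points beyond R accumulate at R + 1. -/
theorem eq_of_eq_on_large_real {F G : ℂ → ℂ} (hF : DifferentiableOn ℂ F {p : ℂ | 0 < p.re})
    (hG : DifferentiableOn ℂ G {p : ℂ | 0 < p.re}) {R : ℝ} (hR : 0 ≤ R)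
    (h : ∀ p : ℝ, R < p → F p = G p) {p : ℂ} (hp : 0 < p.re) : F p = G p := by
  have hopen : IsOpen {p : ℂ | 0 < p.re} := isOpen_lt continuous_const Complex.continuous_re
  have hconn : IsPreconnected {p : ℂ | 0 < p.re} :=
    (convex_halfSpace_re_gt 0).isPreconnected
  refine (hF.analyticOnNhd hopen).eqOn_of_preconnected_of_frequently_eq (hG.analyticOnNhd hopen)
    hconn (z₀ := ((R + 1 : ℝ) : ℂ)) (by simp; linarith) ?_ hp
  have h1 : ∃ᶠ t : ℝ in nhdsWithin (R + 1) {R + 1}ᶜ, F t = G t := by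
    refine Filter.Eventually.frequently ?_
    filter_upwards [mem_nhdsWithin_of_mem_nhds (Ioi_mem_nhds (lt_add_one R))] with t ht
    exact h t ht
  refine Filter.Tendsto.frequently (f := fun t : ℝ => (t : ℂ)) ?_ h1
  refine tendsto_nhdsWithin_iff.2 ⟨?_, ?_⟩
  · exact (Complex.continuous_ofReal.tendsto _).mono_left nhdsWithin_le_nhds
  · filter_upwards [self_mem_nhdsWithin] with t ht h
    exact ht (Complex.ofReal_injective h)

theorem integrableOn_rpow_mul_exp {r p : ℝ} (hr : -1 < r) (hp : 0 < p) :
    IntegrableOn (fun x : ℝ => x ^ r * Real.exp (-p * x)) (Set.Ioi 0) := by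
  simpa using integrableOn_rpow_mul_exp_neg_mul_rpow hr zero_lt_one hp

theorem cpow_differentiableOn_re_pos (a : ℂ) {w : ℂ} (hw : w.re = 0) :
    DifferentiableOn ℂ (fun p : ℂ => (p + w) ^ a) {p : ℂ | 0 < p.re} := by
  intro p hp
  have hp : 0 < p.re := hp
  refine (DifferentiableAt.cpow (by fun_prop) (by fun_prop) (Or.inl ?_)).differentiableWithinAt
  simpa [hw] using hp

/-- Euler's integral with a complex scaling parameter. -/
theorem integral_cpow_mul_exp_neg_mul {a p : ℂ} (ha : 0 < a.re) (hp : 0 < p.re) :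
    ∫ x in Set.Ioi (0 : ℝ), Complex.exp (-p * x) * (x : ℂ) ^ (a - 1) =
        p ^ (-a) * Complex.Gamma a := by
  have hm : AEStronglyMeasurable (fun x : ℝ => (x : ℂ) ^ (a - 1)) (volume.restrict (Set.Ioi 0)) :=
    (Complex.measurable_ofReal.pow_const _).aestronglyMeasurable
  have hF := differentiableOn_laplace hm fun ε hε => ?_
  · have hG : DifferentiableOn ℂ (fun p : ℂ => p ^ (-a) * Complex.Gamma a) {p : ℂ | 0 < p.re} := by
      have := (cpow_differentiableOn_re_pos (-a) Complex.zero_re).mul_const (Complex.Gamma a)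
      simpa using this
    refine eq_of_eq_on_large_real hF hG le_rfl (fun r hr => ?_) hp
    have := Complex.integral_cpow_mul_exp_neg_mul_Ioi ha hr
    rw [one_div, Complex.inv_cpow _ _
      (by rw [Complex.arg_ofReal_of_nonneg hr.le]; exact Real.pi_pos.ne),
      ← Complex.cpow_neg] at this
    rw [← this]
    congr 1
    ext x
    rw [mul_comm, neg_mul]
  · have h1 := integrableOn_rpow_mul_exp (r := a.re - 1) (by linarith) hε
    refine h1.congr_fun (fun x hx => ?_) measurableSet_Ioi
    simp only
    rw [Complex.norm_cpow_eq_rpow_re_of_pos hx, mul_comm]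
    simp

theorem exists_norm_Z_le {s : ℂ} (hs : -(1 / 2 : ℝ) < s.re) :
    ∃ C : ℝ, 0 ≤ C ∧ ∀ x : ℝ, ‖Z s x‖ ≤ C * (1 + |x| ^ (-s.re)) := by
  obtain ⟨B, hB0, hB⟩ := exists_rpow_abs_mul_norm_Z_le hs
  obtain ⟨B', hB'⟩ := (isCompact_Icc (a := (-1 : ℝ)) (b := 1)).exists_bound_of_continuousOn
    (continuous_Z hs).continuousOn
  have hB'0 : 0 ≤ B' := (norm_nonneg _).trans (hB' 0 (by simp))
  refine ⟨B + B', by positivity, fun x => ?_⟩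
  have hm : 0 ≤ |x| ^ (-s.re) := Real.rpow_nonneg (abs_nonneg _) _
  rcases le_total 1 |x| with h | h
  · have hx : 0 < |x| := by linarith
    have h1 := hB x h
    rw [mul_comm, ← le_div_iff₀ (Real.rpow_pos_of_pos hx _), div_eq_mul_inv,
      ← Real.rpow_neg hx.le] at h1
    nlinarith
  · have h2 := hB' x (abs_le.1 h)
    nlinarith

theorem integrableOn_exp_mul_norm_rpow_mul_Z {s : ℂ} (hs : -(1 / 2 : ℝ) < s.re) (ω : ℝ) {ε : ℝ}
    (hε : 0 < ε) :
    IntegrableOn (fun x : ℝ => Real.exp (-ε * x) * ‖Complex.exp (-(Complex.I * ω * x)) *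
      (((x ^ (2 * s.re) : ℝ) : ℂ) * Z s (ω * x))‖) (Set.Ioi 0) := by
  obtain ⟨C, hC0, hC⟩ := exists_norm_Z_le hs
  have h1 := (integrableOn_rpow_mul_exp (r := 2 * s.re) (by linarith) hε).const_mul C
  have h2 := (integrableOn_rpow_mul_exp (r := s.re) (by linarith) hε).const_mul (C * |ω| ^ (-s.re))
  refine (h1.add h2).mono' ?_ ((ae_restrict_iff' measurableSet_Ioi).2
    (Filter.Eventually.of_forall fun x hx => ?_))
  · have hZ := (continuous_Z hs).measurable
    have : Measurable fun x : ℝ => x ^ (2 * s.re) := measurable_id.pow_const _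
    exact Measurable.aestronglyMeasurable (by fun_prop)
  · have hx : 0 < x := hx
    have e1 : ‖Complex.exp (-(Complex.I * ω * x))‖ = 1 := by
      rw [Complex.norm_exp]; simp
    have e2 : x ^ (2 * s.re) * x ^ (-s.re) = x ^ s.re := by
      rw [← Real.rpow_add hx]; congr 1; ring
    rw [norm_mul, norm_norm, Real.norm_of_nonneg (Real.exp_pos _).le, norm_mul, e1, one_mul,
      norm_mul, Complex.norm_real, Real.norm_of_nonneg (Real.rpow_nonneg hx.le _)]
    have h3 := hC (ω * x)
    rw [abs_mul, abs_of_pos hx, Real.mul_rpow (abs_nonneg _) hx.le] at h3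
    calc _ ≤ Real.exp (-ε * x) * (x ^ (2 * s.re) * (C * (1 + |ω| ^ (-s.re) * x ^ (-s.re)))) := by
          have := Real.rpow_nonneg hx.le (2 * s.re)
          gcongr
      _ = _ := by
          simp only [Pi.add_apply]
          rw [← e2]
          ring

/-- The Laplace transform of `x^{2 Re s} e^{-iωx} Z(ωx)` for large real parameters. -/
theorem laplace_Z_of_large {s : ℂ} (hs : -(1 / 2 : ℝ) < s.re) (ω p : ℝ)
    (hp : 2 * ((1 + ‖s‖) * (|ω| + 1)) < p) :
    ∫ x in Set.Ioi (0 : ℝ), Complex.exp (-p * x) * (Complex.exp (-(Complex.I * ω * x)) *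
      (((x ^ (2 * s.re) : ℝ) : ℂ) * Z s (ω * x))) =
      Complex.Gamma (1 + s) * (((p : ℂ) + Complex.I * ω) ^ (-(1 + s)) * (p : ℂ) ^ (-conj s)) := by
  have hb := one_add_two_re_pos hs
  have hb' : 0 < 1 + 2 * s.re := by linarith
  have hR1 : |ω| + 1 ≤ (1 + ‖s‖) * (|ω| + 1) := by nlinarith [norm_nonneg s, abs_nonneg ω]
  have hp0 : 0 < p := by linarith [abs_nonneg ω]
  have hpC : (p : ℂ) ≠ 0 := by exact_mod_cast hp0.ne'
  have hGb : Complex.Gamma (1 + 2 * (s.re : ℂ)) ≠ 0 := Complex.Gamma_ne_zero_of_re_pos hb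
  set b : ℂ := 1 + 2 * (s.re : ℂ) with hbdef
  have hbs : b - conj s = 1 + s := by
    have := Complex.add_conj s
    push_cast at this
    rw [hbdef]
    linear_combination -this
  -- The terms of the integrand after Kummer. Each integrates to a Gamma value whose (b)_k cancels
  -- the denominator of the coefficient, which leaves a binomial series.
  set F : ℕ → ℝ → ℂ := fun k x => Complex.exp (-(p * x)) * ((x : ℂ) ^ (b + k - 1)) *
    (hypCoeff (1 + s) b k * (-(Complex.I * ω)) ^ k) with hF
  have hbk : ∀ k : ℕ, 0 < (b + k).re := fun k => by
    have : (0 : ℝ) ≤ k := Nat.cast_nonneg k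
    simp only [Complex.add_re, Complex.natCast_re]
    linarith
  have hnormpow : ∀ (k : ℕ) (x : ℝ), 0 < x →
      ‖Complex.exp (-(p * x)) * (x : ℂ) ^ (b + k - 1)‖ =
        x ^ (1 + 2 * s.re + k - 1) * Real.exp (-p * x) := by
    intro k x hx
    rw [norm_mul, Complex.norm_cpow_eq_rpow_re_of_pos hx, Complex.norm_exp, mul_comm]
    congr 2
    · simp [hbdef]
    · simp
  have hGammaR : ∀ k : ℕ, ∫ x in Set.Ioi (0 : ℝ), x ^ (1 + 2 * s.re + k - 1) * Real.exp (-p * x) =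
      (1 / p) ^ (1 + 2 * s.re + k) * Real.Gamma (1 + 2 * s.re + k) := by
    intro k
    have := Real.integral_rpow_mul_exp_neg_mul_Ioi (a := 1 + 2 * s.re + k) (r := p)
      (by positivity) hp0
    simpa only [neg_mul] using this
  have hFint : ∀ k, IntegrableOn (F k) (Set.Ioi 0) := by
    intro k
    refine Integrable.mul_const ?_ _
    have hk : (0 : ℝ) ≤ k := Nat.cast_nonneg k
    refine (integrableOn_rpow_mul_exp (r := 1 + 2 * s.re + k - 1) (by linarith) hp0).mono' ?_
      ((ae_restrict_iff' measurableSet_Ioi).2 (Filter.Eventually.of_forall fun x hx => ?_))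
    · have h1 : Measurable fun x : ℝ => (x : ℂ) ^ (b + k - 1) :=
        Complex.measurable_ofReal.pow_const _
      exact Measurable.aestronglyMeasurable (by fun_prop)
    · exact (hnormpow k x hx).le
  have hFval : ∀ k, ∫ x in Set.Ioi (0 : ℝ), F k x = Complex.Gamma b * (p : ℂ) ^ (-b) *
      ((ascPochhammer ℂ k).eval (1 + s) / (k.factorial : ℂ) * (-(Complex.I * ω) / p) ^ k) := by
    intro k
    have h1 := integral_cpow_mul_exp_neg_mul (p := (p : ℂ)) (hbk k) (by simpa using hp0)
    have hG : Complex.Gamma (b + k) = (ascPochhammer ℂ k).eval b * Complex.Gamma b := by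
      clear h1 hFint
      induction k with
      | zero => simp
      | succ k ih =>
        have : b + k ≠ 0 := fun h => by
          have := hbk k
          rw [h] at this
          simp at this
        push_cast
        rw [← add_assoc, Complex.Gamma_add_one _ this, ih, ascPochhammer_succ_eval]
        ring
    simp only [hF]
    rw [integral_mul_const]
    simp only [neg_mul] at h1
    rw [h1, hG, neg_add, Complex.cpow_add _ _ hpC, Complex.cpow_neg _ (k : ℂ), Complex.cpow_natCast,
      div_pow, hypCoeff]
    have := ascPochhammer_eval_ne_zero hb k
    field_simp
  have hFnorm : ∀ k, ∫ x in Set.Ioi (0 : ℝ), ‖F k x‖ = Real.Gamma (1 + 2 * s.re) *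
      (1 / p) ^ (1 + 2 * s.re) *
      (‖(ascPochhammer ℂ k).eval (1 + s) / (k.factorial : ℂ) * (-(Complex.I * ω) / p) ^ k‖) := by
    intro k
    have h1 : ∫ x in Set.Ioi (0 : ℝ), ‖F k x‖ = ∫ x in Set.Ioi (0 : ℝ),
        x ^ (1 + 2 * s.re + k - 1) * Real.exp (-p * x) *
          ‖hypCoeff (1 + s) b k * (-(Complex.I * ω)) ^ k‖ := by
      refine setIntegral_congr_fun measurableSet_Ioi fun x hx => ?_
      simp only [hF]
      rw [norm_mul, hnormpow k x hx]
    rw [h1, integral_mul_const, hGammaR]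
    have hG : Real.Gamma (1 + 2 * s.re + k) =
        ‖(ascPochhammer ℂ k).eval b‖ * Real.Gamma (1 + 2 * s.re) := by
      clear h1
      induction k with
      | zero => simp
      | succ k ih =>
        have h2 : (0 : ℝ) < 1 + 2 * s.re + k := by positivity
        push_cast
        rw [← add_assoc, Real.Gamma_add_one h2.ne', ih, ascPochhammer_succ_eval, norm_mul]
        have : ‖b + k‖ = 1 + 2 * s.re + k := by
          have e : b + k = ((1 + 2 * s.re + k : ℝ) : ℂ) := by rw [hbdef]; push_cast; ring
          rw [e, Complex.norm_real, Real.norm_of_nonneg h2.le]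
        rw [this]
        ring
    rw [hG, Real.rpow_add_natCast (by positivity), hypCoeff]
    simp only [norm_mul, norm_div, norm_pow, norm_neg, Complex.norm_I, Complex.norm_real,
      Real.norm_of_nonneg hp0.le, one_mul]
    have := norm_ne_zero_iff.2 (ascPochhammer_eval_ne_zero hb k)
    have hk0 : ‖(k.factorial : ℂ)‖ ≠ 0 := norm_ne_zero_iff.2 (by exact_mod_cast k.factorial_ne_zero)
    rw [div_pow, div_pow, one_pow]
    field_simp
  have hz : ‖-(Complex.I * ω) / (p : ℂ)‖ = |ω| / p := by
    simp [abs_of_pos hp0]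
  -- The lower bound on p makes the ratio of consecutive terms at most (1 + ‖s‖)|ω|/p ≤ 1/2.
  have hsum : Summable fun k : ℕ =>
      ‖(ascPochhammer ℂ k).eval (1 + s) / (k.factorial : ℂ) * (-(Complex.I * ω) / p) ^ k‖ := by
    refine summable_of_ratio_norm_eventually_le (r := 1 / 2) (by norm_num)
      (Filter.Eventually.of_forall fun k => ?_)
    rw [norm_norm, norm_norm]
    have e : (ascPochhammer ℂ (k + 1)).eval (1 + s) / ((k + 1).factorial : ℂ) *
        (-(Complex.I * ω) / p) ^ (k + 1) = ((1 + s + k) / (k + 1 : ℕ) * (-(Complex.I * ω) / p)) *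
        ((ascPochhammer ℂ k).eval (1 + s) / (k.factorial : ℂ) * (-(Complex.I * ω) / p) ^ k) := by
      rw [ascPochhammer_succ_eval, Nat.factorial_succ, pow_succ, Nat.cast_mul,
        mul_comm ((k + 1 : ℕ) : ℂ),
        ← div_mul_div_comm]
      ring
    rw [e, norm_mul]
    gcongr
    rw [norm_mul, hz, norm_div, Complex.norm_natCast]
    have h1 : ‖1 + s + k‖ / ((k + 1 : ℕ) : ℝ) ≤ 1 + ‖s‖ := by
      rw [div_le_iff₀ (by positivity)]
      have : ‖1 + s + k‖ ≤ 1 + ‖s‖ + k := by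
        refine (norm_add_le _ _).trans ?_
        rw [Complex.norm_natCast]
        have := norm_add_le 1 s
        rw [norm_one] at this
        linarith
      push_cast
      nlinarith [norm_nonneg s, (Nat.cast_nonneg k : (0 : ℝ) ≤ k)]
    calc _ ≤ (1 + ‖s‖) * (|ω| / p) := by gcongr
      _ ≤ 1 / 2 := by
        rw [← mul_div_assoc, div_le_div_iff₀ hp0 two_pos]
        nlinarith [norm_nonneg s]
  have hlt : ‖-(Complex.I * ω) / (p : ℂ)‖ < 1 := by
    rw [hz, div_lt_one hp0]
    linarith
  have hmain := hasSum_integral_of_summable_integral_norm (μ := volume.restrict (Set.Ioi (0 : ℝ)))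
    hFint (by simp only [hFnorm]; exact hsum.mul_left _)
  simp only [hFval] at hmain
  have hbin := (hasSum_binomial (1 + s) hlt).mul_left (Complex.Gamma b * (p : ℂ) ^ (-b))
  have heq := hmain.unique hbin
  have hint : ∫ x in Set.Ioi (0 : ℝ), Complex.exp (-p * x) * (Complex.exp (-(Complex.I * ω * x)) *
      (((x ^ (2 * s.re) : ℝ) : ℂ) * Z s (ω * x))) =
      zConst s * ∫ x in Set.Ioi (0 : ℝ), ∑' k, F k x := by
    rw [← integral_const_mul]
    refine setIntegral_congr_fun measurableSet_Ioi fun x hx => ?_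
    have hx : 0 < x := hx
    have hxC : (x : ℂ) ≠ 0 := by exact_mod_cast hx.ne'
    -- Kummer absorbs e^{-iωx} and turns the parameter s̄ into 1 + s.
    have hK := hyp1F1_eq_exp_mul hb (conj s) (Complex.I * (ω * x : ℝ))
    rw [hbs] at hK
    simp only [Z_eq]
    rw [← hbdef, hK, hyp1F1_eq]
    have e1 : Complex.exp (-(Complex.I * ω * x)) * Complex.exp (Complex.I * (ω * x : ℝ)) = 1 := by
      rw [← Complex.exp_add]; push_cast; ring_nf; simp
    have e2 : ((x ^ (2 * s.re) : ℝ) : ℂ) = (x : ℂ) ^ (b - 1) := by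
      rw [Complex.ofReal_cpow hx.le, hbdef]
      congr 1
      push_cast
      ring
    have e3 : ∑' k, F k x = Complex.exp (-p * x) * (x : ℂ) ^ (b - 1) *
        ∑' k, hypCoeff (1 + s) b k * (-(Complex.I * (ω * x : ℝ))) ^ k := by
      rw [← tsum_mul_left]
      refine tsum_congr fun k => ?_
      simp only [hF]
      rw [show b + k - 1 = (b - 1) + k by ring, Complex.cpow_add _ _ hxC, Complex.cpow_natCast,
        show -(Complex.I * ((ω * x : ℝ) : ℂ)) = -(Complex.I * ω) * x by push_cast; ring, mul_pow,
        neg_mul]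
      ring
    rw [e3, e2]
    linear_combination (Complex.exp (-p * x) * (x : ℂ) ^ (b - 1) * zConst s *
      ∑' k, hypCoeff (1 + s) b k * (-(Complex.I * (ω * x : ℝ))) ^ k) * e1
  rw [hint, heq]
  have hfac : (p : ℂ) + Complex.I * ω = (p : ℂ) * (1 - -(Complex.I * ω) / p) := by
    field_simp
    ring
  have hre : 0 < (1 - -(Complex.I * ω) / (p : ℂ)).re := by
    have := (abs_le.1 (Complex.abs_re_le_norm (-(Complex.I * ω) / (p : ℂ)))).2
    rw [Complex.sub_re, Complex.one_re]
    linarith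
  have hne : 1 - -(Complex.I * ω) / (p : ℂ) ≠ 0 := fun h => by
    rw [h] at hre
    simp at hre
  rw [hfac, mul_cpow_of_arg_add_mem hpC hne (by
      rw [Complex.arg_ofReal_of_nonneg hp0.le, zero_add]
      exact Complex.arg_mem_Ioc _), show -b = -(1 + s) + -conj s by rw [← hbs]; ring,
    Complex.cpow_add _ _ hpC, zConst, ← hbdef]
  field_simp

/-- The Laplace transform of `x^{2 Re s} e^{-iωx} Z(ωx)`. -/
theorem laplace_Z {s : ℂ} (hs : -(1 / 2 : ℝ) < s.re) (ω : ℝ) {p : ℂ} (hp : 0 < p.re) :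
    ∫ x in Set.Ioi (0 : ℝ), Complex.exp (-p * x) * (Complex.exp (-(Complex.I * ω * x)) *
      (((x ^ (2 * s.re) : ℝ) : ℂ) * Z s (ω * x))) =
      Complex.Gamma (1 + s) * ((p + Complex.I * ω) ^ (-(1 + s)) * p ^ (-conj s)) := by
  have hm : AEStronglyMeasurable (fun x : ℝ => Complex.exp (-(Complex.I * ω * x)) *
      (((x ^ (2 * s.re) : ℝ) : ℂ) * Z s (ω * x))) (volume.restrict (Set.Ioi 0)) := by
    have hZ := (continuous_Z hs).measurable
    have : Measurable fun x : ℝ => x ^ (2 * s.re) := measurable_id.pow_const _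
    exact Measurable.aestronglyMeasurable (by fun_prop)
  have hF := differentiableOn_laplace hm fun ε hε => integrableOn_exp_mul_norm_rpow_mul_Z hs ω hε
  have hG : DifferentiableOn ℂ (fun p : ℂ => Complex.Gamma (1 + s) *
      ((p + Complex.I * ω) ^ (-(1 + s)) * p ^ (-conj s))) {p : ℂ | 0 < p.re} := by
    have h1 := cpow_differentiableOn_re_pos (-(1 + s)) (w := Complex.I * ω) (by simp)
    have h2 := cpow_differentiableOn_re_pos (-conj s) Complex.zero_re
    simp only [add_zero] at h2
    exact (h1.mul h2).const_mul _
  exact eq_of_eq_on_large_real hF hG (by positivity) (fun r hr => laplace_Z_of_large hs ω r hr) hp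

/-! ### Plancherel for functions in L¹ ∩ L² -/

open FourierTransform in
/-- The `L²` Fourier transform of an integrable function is given by the Fourier integral. -/
theorem coeFn_fourier_toLp {f : ℝ → ℂ} (h1 : Integrable f) (h2 : MemLp f 2) :
    ((𝓕 (h2.toLp f) : L2) : ℝ → ℂ) =ᵐ[volume] 𝓕 f := by
  have hcont : Continuous (𝓕 f) :=
    VectorFourier.fourierIntegral_continuous Real.continuous_fourierChar
      (by fun_prop) h1
  refine ae_eq_of_integral_contDiff_smul_eq ((Lp.memLp _).locallyIntegrable (by norm_num))
    hcont.locallyIntegrable fun g hg hgs => ?_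
  have hgs' : HasCompactSupport (fun x => (g x : ℂ)) := hgs.comp_left Complex.ofReal_zero
  set φ : SchwartzMap ℝ ℂ := hgs'.toSchwartzMap (Complex.ofRealCLM.contDiff.comp hg) with hφ
  have hφx : ∀ x, φ x = g x := fun x => rfl
  -- The two transforms agree as tempered distributions; the Fourier transform is moved from f to
  -- the test function and back by Fubini.
  have key := congrArg (fun T => T φ) (Lp.fourier_toTemperedDistribution_eq (h2.toLp f))
  simp only [TemperedDistribution.fourier_apply, Lp.toTemperedDistribution_apply] at key
  have h3 : ∫ x, (𝓕 φ) x • (h2.toLp f) x = ∫ x, (𝓕 φ) x • f x := by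
    refine integral_congr_ae ?_
    filter_upwards [h2.coeFn_toLp] with x hx
    rw [hx]
  have h4 : ∫ x, (𝓕 (φ : ℝ → ℂ)) x • f x = ∫ x, φ x • (𝓕 f) x := by
    have := VectorFourier.integral_fourierIntegral_smul_eq_flip (e := Real.fourierChar)
      (μ := volume) (ν := volume) (L := innerₗ ℝ) (f := (φ : ℝ → ℂ)) (g := f)
      Real.continuous_fourierChar (by fun_prop) φ.integrable h1
    rw [flip_innerₗ] at this
    exact this
  rw [h3, SchwartzMap.fourier_coe, h4] at key
  simp only [hφx] at key
  simpa using key.symm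

open FourierTransform in
theorem memLp_fourier {f : ℝ → ℂ} (h1 : Integrable f) (h2 : MemLp f 2) : MemLp (𝓕 f) 2 :=
  (memLp_congr_ae (coeFn_fourier_toLp h1 h2)).1 (Lp.memLp _)

open FourierTransform in
theorem integral_conj_fourier_mul_fourier {f g : ℝ → ℂ} (hf1 : Integrable f) (hf2 : MemLp f 2)
    (hg1 : Integrable g) (hg2 : MemLp g 2) :
    ∫ ξ, conj (𝓕 f ξ) * 𝓕 g ξ = ∫ x, conj (f x) * g x := by
  have h := Lp.inner_fourier_eq (hf2.toLp f) (hg2.toLp g)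
  rw [L2.inner_def, L2.inner_def] at h
  simp only [RCLike.inner_apply] at h
  have h1 : ∫ ξ, conj (𝓕 f ξ) * 𝓕 g ξ =
      ∫ ξ, (𝓕 (hg2.toLp g) : L2) ξ * conj ((𝓕 (hf2.toLp f) : L2) ξ) := by
    refine integral_congr_ae ?_
    filter_upwards [coeFn_fourier_toLp hf1 hf2, coeFn_fourier_toLp hg1 hg2] with x hx hx'
    rw [hx, hx', mul_comm]
  have h2 : ∫ x, conj (f x) * g x = ∫ x, (hg2.toLp g) x * conj ((hf2.toLp f) x) := by
    refine integral_congr_ae ?_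
    filter_upwards [hf2.coeFn_toLp, hg2.coeFn_toLp] with x hx hx'
    rw [hx, hx', mul_comm]
  rw [h1, h2]
  exact h

/-! ### Power-exponential functions on a half-line -/

/-- The function `x^a e^{-px}` on the positive half-line, extended by zero. -/
def powExp (a : ℂ) (p : ℝ) : ℝ → ℂ :=
  (Set.Ioi 0).indicator fun x : ℝ => Complex.exp (-p * x) * (x : ℂ) ^ a

theorem powExp_of_pos (a : ℂ) (p : ℝ) {x : ℝ} (hx : 0 < x) :
    powExp a p x = Complex.exp (-p * x) * (x : ℂ) ^ a :=
  Set.indicator_of_mem (s := Set.Ioi (0 : ℝ)) hx _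

theorem powExp_of_nonpos (a : ℂ) (p : ℝ) {x : ℝ} (hx : x ≤ 0) : powExp a p x = 0 :=
  Set.indicator_of_notMem (s := Set.Ioi (0 : ℝ)) (not_lt.2 hx) _

theorem measurable_powExp (a : ℂ) (p : ℝ) : Measurable (powExp a p) := by
  refine Measurable.indicator ?_ measurableSet_Ioi
  have : Measurable fun x : ℝ => (x : ℂ) ^ a := Complex.measurable_ofReal.pow_const _
  fun_prop

theorem norm_powExp_of_pos (a : ℂ) (p : ℝ) {x : ℝ} (hx : 0 < x) :
    ‖powExp a p x‖ = x ^ a.re * Real.exp (-p * x) := by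
  rw [powExp_of_pos a p hx, norm_mul, Complex.norm_exp, Complex.norm_cpow_eq_rpow_re_of_pos hx,
    mul_comm]
  simp

theorem integrable_powExp {a : ℂ} {p : ℝ} (ha : -1 < a.re) (hp : 0 < p) :
    Integrable (powExp a p) := by
  refine (integrable_indicator_iff measurableSet_Ioi).2 ?_
  refine (integrableOn_rpow_mul_exp ha hp).mono' ?_
    ((ae_restrict_iff' measurableSet_Ioi).2 (Filter.Eventually.of_forall fun x hx => ?_))
  · have : Measurable fun x : ℝ => (x : ℂ) ^ a := Complex.measurable_ofReal.pow_const _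
    exact Measurable.aestronglyMeasurable (by fun_prop)
  · rw [← norm_powExp_of_pos a p hx, powExp_of_pos a p hx]

theorem memLp_powExp {a : ℂ} {p : ℝ} (ha : -(1 / 2 : ℝ) < a.re) (hp : 0 < p) :
    MemLp (powExp a p) 2 := by
  rw [memLp_two_iff_integrable_sq_norm (measurable_powExp a p).aestronglyMeasurable]
  have h := integrableOn_rpow_mul_exp (r := 2 * a.re) (p := 2 * p) (by linarith) (by positivity)
  rw [← integrable_indicator_iff measurableSet_Ioi] at h
  refine h.congr (Filter.Eventually.of_forall fun x => ?_)
  simp only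
  rcases le_or_gt x 0 with hx | hx
  · rw [powExp_of_nonpos a p hx, Set.indicator_of_notMem (by simpa using hx)]
    simp
  · rw [Set.indicator_of_mem (Set.mem_Ioi.2 hx), norm_powExp_of_pos a p hx, mul_pow,
      ← Real.rpow_natCast, ← Real.rpow_mul hx.le, ← Real.exp_nat_mul]
    congr 2
    · push_cast; ring
    · push_cast; ring

theorem integral_conj_powExp_mul_powExp {a : ℂ} {p q : ℝ} (ha : -(1 / 2 : ℝ) < a.re) (hp : 0 < p)
    (hq : 0 < q) : ∫ x, conj (powExp a p x) * powExp a q x =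
      (((1 / (p + q)) ^ (1 + 2 * a.re) * Real.Gamma (1 + 2 * a.re) : ℝ) : ℂ) := by
  have h1 : ∀ x, conj (powExp a p x) * powExp a q x = (Set.Ioi 0).indicator
      (fun x : ℝ => ((x ^ (1 + 2 * a.re - 1) * Real.exp (-((p + q) * x)) : ℝ) : ℂ)) x := by
    intro x
    rcases le_or_gt x 0 with hx | hx
    · rw [powExp_of_nonpos a p hx, Set.indicator_of_notMem (by simpa using hx)]
      simp
    · rw [Set.indicator_of_mem (Set.mem_Ioi.2 hx), powExp_of_pos a p hx, powExp_of_pos a q hx]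
      have e1 : conj ((x : ℂ) ^ a) * (x : ℂ) ^ a = ((x ^ (1 + 2 * a.re - 1) : ℝ) : ℂ) := by
        rw [mul_comm, Complex.mul_conj, Complex.normSq_eq_norm_sq,
          Complex.norm_cpow_eq_rpow_re_of_pos hx, ← Real.rpow_natCast, ← Real.rpow_mul hx.le]
        congr 2
        push_cast
        ring
      have e2 : conj (Complex.exp (-p * x)) * Complex.exp (-q * x) =
          ((Real.exp (-((p + q) * x)) : ℝ) : ℂ) := by
        rw [← Complex.exp_conj, ← Complex.exp_add, Complex.ofReal_exp]
        congr 1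
        simp
        ring
      rw [map_mul, Complex.ofReal_mul, ← e1, ← e2]
      ring
  simp only [h1]
  rw [integral_indicator measurableSet_Ioi, integral_complex_ofReal,
    Real.integral_rpow_mul_exp_neg_mul_Ioi (by linarith) (by positivity)]

theorem integral_comp_mul_of_sign {E : Type*} [NormedAddCommGroup E] [NormedSpace ℝ E] {σ : ℝ}
    (hσ : σ = 1 ∨ σ = -1) (F : ℝ → E) : ∫ x, F (σ * x) = ∫ x, F x := by
  rcases hσ with rfl | rfl
  · simp
  · simpa using integral_neg_eq_self F volume

theorem integral_conj_powExp_mul_powExp_comp_of_ne {a : ℂ} {p q σ τ : ℝ} (hσ : σ = 1 ∨ σ = -1)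
    (hτ : τ = 1 ∨ τ = -1) (hne : σ ≠ τ) :
    ∫ x, conj (powExp a p (σ * x)) * powExp a q (τ * x) = 0 := by
  have hτσ : τ = -σ := by
    rcases hσ with rfl | rfl <;> rcases hτ with rfl | rfl <;> simp at hne ⊢
  refine integral_eq_zero_of_ae (Filter.Eventually.of_forall fun x => ?_)
  subst hτσ
  rcases le_total (σ * x) 0 with h | h
  · simp [powExp_of_nonpos a p h]
  · have h' := powExp_of_nonpos a q (by linarith : -σ * x ≤ 0)
    simp only [h', mul_zero, Pi.zero_apply]

theorem integrable_comp_mul_of_sign {E : Type*} [NormedAddCommGroup E] {σ : ℝ}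
    (hσ : σ = 1 ∨ σ = -1) {F : ℝ → E} (hF : Integrable F) : Integrable fun x => F (σ * x) :=
  hF.comp_mul_left' (by rcases hσ with rfl | rfl <;> simp)

theorem memLp_comp_mul_of_sign {σ : ℝ} (hσ : σ = 1 ∨ σ = -1) {F : ℝ → ℂ} {r : ℝ≥0∞}
    (hF : MemLp F r) : MemLp (fun x => F (σ * x)) r := by
  rcases hσ with rfl | rfl
  · simpa using hF
  · have := hF.comp_measurePreserving (Measure.measurePreserving_neg (volume : Measure ℝ))
    simpa [Function.comp_def] using this

open FourierTransform in
theorem fourier_powExp_comp {a : ℂ} {p σ : ℝ} (ha : -1 < a.re) (hp : 0 < p)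
    (hσ : σ = 1 ∨ σ = -1) (ξ : ℝ) :
    𝓕 (fun x => powExp a p (σ * x)) ξ =
      ((p : ℂ) + Complex.I * (σ * (2 * Real.pi * ξ) : ℝ)) ^ (-(1 + a)) * Complex.Gamma (1 + a) := by
  have hσ2 : σ * σ = 1 := by rcases hσ with rfl | rfl <;> norm_num
  rw [Real.fourier_real_eq_integral_exp_smul, ← integral_comp_mul_of_sign hσ]
  have h1 : ∀ v : ℝ, Complex.exp (((-2 * Real.pi * (σ * v) * ξ : ℝ) : ℂ) * Complex.I) •
      powExp a p (σ * (σ * v)) = (Set.Ioi 0).indicator (fun v : ℝ =>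
        Complex.exp (-((p : ℂ) + Complex.I * (σ * (2 * Real.pi * ξ) : ℝ)) * v) *
          (v : ℂ) ^ (1 + a - 1)) v := by
    intro v
    rw [← mul_assoc σ σ, hσ2, one_mul, smul_eq_mul]
    rcases le_or_gt v 0 with hv | hv
    · rw [powExp_of_nonpos a p hv, Set.indicator_of_notMem (by simpa using hv), mul_zero]
    · rw [powExp_of_pos a p hv, Set.indicator_of_mem (Set.mem_Ioi.2 hv), ← mul_assoc,
        ← Complex.exp_add, add_sub_cancel_left]
      congr 2
      push_cast
      ring
  simp only [h1]
  rw [integral_indicator measurableSet_Ioi, integral_cpow_mul_exp_neg_mul]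
  · simp; linarith
  · simpa using hp

/-! ### The transform of power-exponential functions -/

/-- `rho` times the conjugate of `psi` is the principal power (ix)^s, since arg(ix) = (π/2) sign x.
-/
theorem genExp_of_ne_zero (s : ℂ) {x : ℝ} (hx : x ≠ 0) :
    genExp s x = Complex.exp (-(Complex.I * (x : ℂ))) / (Real.sqrt (2 * Real.pi) : ℂ) *
      (Complex.I * x) ^ s * Z s x := by
  have habs : 0 < |x| := abs_pos.2 hx
  have habsC : ((|x| : ℝ) : ℂ) ≠ 0 := by exact_mod_cast habs.ne'
  have hlog : Complex.log (Complex.I * x) =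
      (Real.log |x| : ℝ) + Complex.I * (Real.pi / 2) * (Real.sign x : ℝ) := by
    rcases lt_or_gt_of_ne hx with h | h
    · have e : Complex.I * (x : ℂ) = (|x| : ℝ) * -Complex.I := by
        rw [abs_of_neg h]; push_cast; ring
      rw [e, Complex.log_ofReal_mul habs (neg_ne_zero.2 Complex.I_ne_zero), Complex.log_neg_I,
        Real.sign_of_neg h]
      push_cast
      ring
    · have e : Complex.I * (x : ℂ) = (|x| : ℝ) * Complex.I := by
        rw [abs_of_pos h]; ring
      rw [e, Complex.log_ofReal_mul habs Complex.I_ne_zero, Complex.log_I, Real.sign_of_pos h]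
      push_cast
      ring
  have hre := Complex.re_add_im s
  have key : (rho s x : ℂ) * conj (psi s x) = (Complex.I * x) ^ s := by
    have hIx : Complex.I * (x : ℂ) ≠ 0 := mul_ne_zero Complex.I_ne_zero (by exact_mod_cast hx)
    rw [Complex.cpow_def_of_ne_zero hIx, hlog]
    unfold rho psi
    rw [Complex.cpow_def_of_ne_zero habsC, Real.rpow_def_of_pos habs, ← Complex.exp_add,
      ← Complex.exp_conj, ← Real.exp_add, Complex.ofReal_exp, ← Complex.exp_add,
      ← Complex.ofReal_log habs.le]
    congr 1
    have h2 : conj (2 : ℂ) = 2 := Complex.conj_ofNat 2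
    simp only [map_add, map_mul, map_neg, map_div₀, Complex.conj_I, Complex.conj_ofReal, h2]
    push_cast
    nth_rewrite 5 [← hre]
    linear_combination (-(Real.pi / 2) * s.im * Real.sign x : ℂ) * Complex.I_mul_I
  unfold genExp
  rw [← key]
  ring

theorem I_mul_mul_cpow_of_pos {ω x : ℝ} (hω : ω ≠ 0) (hx : 0 < x) (s : ℂ) :
    (Complex.I * ((ω * x : ℝ) : ℂ)) ^ s = (Complex.I * ω) ^ s * (x : ℂ) ^ s := by
  have e : Complex.I * ((ω * x : ℝ) : ℂ) = (x : ℂ) * (Complex.I * ω) := by push_cast; ring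
  rw [e, mul_cpow_of_arg_add_mem (by exact_mod_cast hx.ne')
    (mul_ne_zero Complex.I_ne_zero (by exact_mod_cast hω)) (by
      rw [Complex.arg_ofReal_of_nonneg hx.le, zero_add]
      exact Complex.arg_mem_Ioc _), mul_comm]

/-- The exponent s̄ is chosen so that x^s x^{s̄} = x^{2 Re s}, the power whose Laplace transform
against `Z` is elementary. -/
theorem transform_powExp {s : ℂ} (hs : -(1 / 2 : ℝ) < s.re) {p : ℝ} (hp : 0 < p) {ω : ℝ}
    (hω : ω ≠ 0) :
    transform s (powExp (conj s) p) ω = Complex.Gamma (1 + s) / (Real.sqrt (2 * Real.pi) : ℂ) *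
      (p : ℂ) ^ (-conj s) * ((Complex.I * ω) ^ s * ((p : ℂ) + Complex.I * ω) ^ (-(1 + s))) := by
  have h1 : ∀ x : ℝ, genExp s (ω * x) * powExp (conj s) p x = (Set.Ioi 0).indicator (fun x : ℝ =>
      (Complex.I * ω) ^ s / (Real.sqrt (2 * Real.pi) : ℂ) * (Complex.exp (-(p : ℂ) * x) *
        (Complex.exp (-(Complex.I * ω * x)) * (((x ^ (2 * s.re) : ℝ) : ℂ) * Z s (ω * x))))) x := by
    intro x
    rcases le_or_gt x 0 with hx | hx
    · rw [powExp_of_nonpos _ p hx, Set.indicator_of_notMem (by simpa using hx), mul_zero]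
    · rw [powExp_of_pos _ p hx, Set.indicator_of_mem (Set.mem_Ioi.2 hx),
        genExp_of_ne_zero s (mul_ne_zero hω hx.ne'), I_mul_mul_cpow_of_pos hω hx]
      have e1 : ((x ^ (2 * s.re) : ℝ) : ℂ) = (x : ℂ) ^ s * (x : ℂ) ^ conj s := by
        rw [← Complex.cpow_add _ _ (by exact_mod_cast hx.ne'), Complex.add_conj,
          Complex.ofReal_cpow hx.le]
      have e2 : Complex.exp (-(Complex.I * ω * x)) =
          Complex.exp (-(Complex.I * ((ω * x : ℝ) : ℂ))) := by
        push_cast; ring_nf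
      rw [e1, e2]
      ring
  unfold transform
  simp only [h1]
  rw [integral_indicator measurableSet_Ioi, integral_const_mul, laplace_Z hs ω (by simpa using hp)]
  ring

theorem transform_comp_mul_of_sign (s : ℂ) (f : ℝ → ℂ) {σ : ℝ} (hσ : σ = 1 ∨ σ = -1) (ω : ℝ) :
    transform s (fun x => f (σ * x)) ω = transform s f (σ * ω) := by
  have hσ2 : σ * σ = 1 := by rcases hσ with rfl | rfl <;> norm_num
  unfold transform
  rw [← integral_comp_mul_of_sign hσ]
  congr 1
  ext x
  simp only
  rw [← mul_assoc σ σ, hσ2, one_mul]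
  congr 2
  ring

theorem abs_arg_le_of_re_eq_zero {w : ℂ} (hw : w.re = 0) : |w.arg| ≤ Real.pi / 2 :=
  Complex.abs_arg_le_pi_div_two_iff.2 hw.ge

-- With w = iσω and v = 1/w = iση one has p + w = w p (1/p + v). So w^s (p + w)^{-(1+s)} is v
-- p^{-(1+s)} (1/p + v)^{-(1+s)}, and the last power is the Fourier transform of x^s e^{-x/p} up to
-- Γ(1+s).
open FourierTransform in
theorem transform_powExp_comp_neg_inv {s : ℂ} (hs : -(1 / 2 : ℝ) < s.re) {p σ η : ℝ} (hp : 0 < p)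
    (hσ : σ = 1 ∨ σ = -1) (hη : η ≠ 0) :
    transform s (fun x => powExp (conj s) p (σ * x)) (-η⁻¹) =
      σ * (Complex.I * η) / (Real.sqrt (2 * Real.pi) : ℂ) * ((p ^ (-(1 + 2 * s.re)) : ℝ) : ℂ) *
        𝓕 (fun x => powExp s (1 / p) (σ * x)) (η / (2 * Real.pi)) := by
  have hσ0 : σ ≠ 0 := by rcases hσ with rfl | rfl <;> norm_num
  have hσinv : σ⁻¹ = σ := by rcases hσ with rfl | rfl <;> norm_num
  have hpC : (p : ℂ) ≠ 0 := by exact_mod_cast hp.ne'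
  rw [transform_comp_mul_of_sign s _ hσ, transform_powExp hs hp (by simp [hσ0, hη]),
    fourier_powExp_comp (by linarith) (by positivity) hσ]
  set w : ℂ := Complex.I * ((σ * -η⁻¹ : ℝ) : ℂ) with hw
  set v : ℂ := Complex.I * ((σ * η : ℝ) : ℂ) with hv
  have hwre : w.re = 0 := by rw [hw]; simp
  have hw0 : w ≠ 0 := mul_ne_zero Complex.I_ne_zero (by
    exact_mod_cast mul_ne_zero hσ0 (neg_ne_zero.2 (inv_ne_zero hη)))
  have hvw : w * v = 1 := by
    rw [hw, hv]
    have h1 : ((σ * -η⁻¹ : ℝ) : ℂ) * ((σ * η : ℝ) : ℂ) = -1 := by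
      rw [← Complex.ofReal_mul]
      have : σ * -η⁻¹ * (σ * η) = -1 := by
        rcases hσ with rfl | rfl <;> field_simp
      rw [this]; simp
    linear_combination Complex.I ^ 2 * h1 - Complex.I_sq
  have hvre : v.re = 0 := by rw [hv]; simp
  have e1 : (p : ℂ) + w = w * ((p : ℂ) * (((1 / p : ℝ) : ℂ) + v)) := by
    push_cast
    field_simp
    linear_combination (-(p : ℂ)) * hvw
  have hre : 0 < (((1 / p : ℝ) : ℂ) + v).re := by
    rw [Complex.add_re, hvre, Complex.ofReal_re]; simpa using hp
  have hne : ((1 / p : ℝ) : ℂ) + v ≠ 0 := fun h => by rw [h] at hre; simp at hre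
  have harg1 : ((p : ℂ) * (((1 / p : ℝ) : ℂ) + v)).arg = (((1 / p : ℝ) : ℂ) + v).arg :=
    Complex.arg_real_mul _ hp
  have hargw := abs_le.1 (abs_arg_le_of_re_eq_zero hwre)
  have hargv := abs_lt.1 (Complex.abs_arg_lt_pi_div_two_iff.2 (Or.inl hre))
  -- The principal powers split: |arg w| ≤ π/2 and |arg(1/p + v)| < π/2, so the arguments add up
  -- inside (-π, π).
  have e2 : ((p : ℂ) + w) ^ (-(1 + s)) = w ^ (-(1 + s)) * ((p : ℂ) ^ (-(1 + s)) *
      (((1 / p : ℝ) : ℂ) + v) ^ (-(1 + s))) := by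
    rw [e1, mul_cpow_of_arg_add_mem hw0 (mul_ne_zero hpC hne)
      (by rw [harg1]; constructor <;> linarith [hargw.1, hargw.2, hargv.1, hargv.2]),
      mul_cpow_of_arg_add_mem hpC hne (by
        rw [Complex.arg_ofReal_of_nonneg hp.le, zero_add]
        exact Complex.arg_mem_Ioc _)]
  have e3 : w ^ s * w ^ (-(1 + s)) = v := by
    rw [← Complex.cpow_add _ _ hw0, show s + -(1 + s) = -1 by ring, Complex.cpow_neg_one]
    exact inv_eq_of_mul_eq_one_right hvw
  have e4 : ((p ^ (-(1 + 2 * s.re)) : ℝ) : ℂ) = (p : ℂ) ^ (-conj s) * (p : ℂ) ^ (-(1 + s)) := by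
    rw [← Complex.cpow_add _ _ hpC, Complex.ofReal_cpow hp.le]
    congr 1
    have := Complex.add_conj s
    push_cast at this ⊢
    linear_combination this
  have e5 : Complex.I * ((σ * (2 * Real.pi * (η / (2 * Real.pi))) : ℝ) : ℂ) = v := by
    rw [hv, mul_div_cancel₀ _ (by positivity)]
  have e6 : (σ : ℂ) * (Complex.I * η) = v := by rw [hv]; push_cast; ring
  rw [e2, e4, e5, e6]
  linear_combination (Complex.Gamma (1 + s) / (Real.sqrt (2 * Real.pi) : ℂ) * (p : ℂ) ^ (-conj s) *
    ((p : ℂ) ^ (-(1 + s)) * (((1 / p : ℝ) : ℂ) + v) ^ (-(1 + s)))) * e3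

/-! ### The substitution `ω = -1/η` -/

theorem restrict_compl_zero : (volume : Measure ℝ).restrict {0}ᶜ = volume :=
  Measure.restrict_eq_self_of_ae_mem (compl_mem_ae_iff.2 (by simp))

theorem image_neg_inv_compl_zero : (fun η : ℝ => -η⁻¹) '' {0}ᶜ = {0}ᶜ := by
  ext x
  simp only [Set.mem_image, Set.mem_compl_iff, Set.mem_singleton_iff]
  constructor
  · rintro ⟨y, hy, rfl⟩
    simpa using hy
  · intro hx
    exact ⟨-x⁻¹, by simpa using hx, by simp [inv_neg]⟩

theorem hasDerivWithinAt_neg_inv (x : ℝ) (hx : x ∈ ({0}ᶜ : Set ℝ)) :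
    HasDerivWithinAt (fun η : ℝ => -η⁻¹) ((x ^ 2)⁻¹) {0}ᶜ x := by
  exact ((hasDerivAt_inv (by simpa using hx : x ≠ 0)).fun_neg.congr_deriv
    (neg_neg _)).hasDerivWithinAt

theorem injOn_neg_inv : Set.InjOn (fun η : ℝ => -η⁻¹) {0}ᶜ := fun x _ y _ h => by
  simpa using h

theorem integral_eq_integral_comp_neg_inv {E : Type*} [NormedAddCommGroup E] [NormedSpace ℝ E]
    (F : ℝ → E) : ∫ ω, F ω = ∫ η, (η ^ 2)⁻¹ • F (-η⁻¹) := by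
  have h := integral_image_eq_integral_abs_deriv_smul (measurableSet_singleton (0 : ℝ)).compl
    hasDerivWithinAt_neg_inv injOn_neg_inv F
  rw [image_neg_inv_compl_zero, restrict_compl_zero] at h
  rw [h]
  congr 1
  ext η
  rw [abs_of_nonneg (by positivity)]

theorem integrable_iff_integrable_comp_neg_inv {E : Type*} [NormedAddCommGroup E] [NormedSpace ℝ E]
    (F : ℝ → E) : Integrable F ↔ Integrable fun η => (η ^ 2)⁻¹ • F (-η⁻¹) := by
  have h := integrableOn_image_iff_integrableOn_abs_deriv_smul
    (measurableSet_singleton (0 : ℝ)).compl hasDerivWithinAt_neg_inv injOn_neg_inv F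
  rw [image_neg_inv_compl_zero, IntegrableOn, IntegrableOn, restrict_compl_zero] at h
  rw [h]
  refine integrable_congr (Filter.Eventually.of_forall fun η => ?_)
  simp only
  rw [abs_of_nonneg (by positivity)]

/-! ### The Gram matrix of the transforms -/

theorem measurable_genExp {s : ℂ} (hs : -(1 / 2 : ℝ) < s.re) : Measurable (genExp s) := by
  have hsign : Measurable Real.sign := by
    unfold Real.sign
    exact Measurable.ite measurableSet_Iio measurable_const
      (Measurable.ite measurableSet_Ioi measurable_const measurable_const)
  have hZ := (continuous_Z hs).measurable
  have h1 : Measurable fun x : ℝ => ((|x| : ℝ) : ℂ) ^ (-(Complex.I * (s.im : ℂ))) :=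
    (Complex.measurable_ofReal.comp measurable_norm).pow_const _
  have h2 : Measurable fun x : ℝ => |x| ^ s.re := measurable_norm.pow_const _
  unfold genExp rho psi
  fun_prop

theorem aestronglyMeasurable_transform {s : ℂ} (hs : -(1 / 2 : ℝ) < s.re) {f : ℝ → ℂ}
    (hf : AEStronglyMeasurable f) : AEStronglyMeasurable (transform s f) := by
  have h1 : AEStronglyMeasurable (fun p : ℝ × ℝ => genExp s (p.1 * p.2) * f p.2)
      (volume.prod volume) := by
    refine AEStronglyMeasurable.mul ?_ hf.comp_snd
    exact ((measurable_genExp hs).comp (measurable_fst.mul measurable_snd)).aestronglyMeasurable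
  exact h1.integral_prod_right'

theorem div_two_pi_integral (F : ℝ → ℂ) :
    ∫ η, F (η / (2 * Real.pi)) = (2 * Real.pi : ℂ) * ∫ ξ, F ξ := by
  rw [Measure.integral_comp_div, abs_of_pos (by positivity), Complex.real_smul]
  push_cast
  rfl

open FourierTransform in
theorem memLp_transform_powExp {s : ℂ} (hs : -(1 / 2 : ℝ) < s.re) {p σ : ℝ} (hp : 0 < p)
    (hσ : σ = 1 ∨ σ = -1) :
    MemLp (transform s fun x => powExp (conj s) p (σ * x)) 2 := by
  have hm : AEStronglyMeasurable (fun x => powExp (conj s) p (σ * x)) :=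
    ((measurable_powExp _ p).comp (measurable_const_mul σ)).aestronglyMeasurable
  rw [memLp_two_iff_integrable_sq_norm (aestronglyMeasurable_transform hs hm),
    integrable_iff_integrable_comp_neg_inv]
  have hg1 : Integrable fun x => powExp s (1 / p) (σ * x) :=
    integrable_comp_mul_of_sign hσ (integrable_powExp (by linarith) (by positivity))
  have hg2 : MemLp (fun x => powExp s (1 / p) (σ * x)) 2 :=
    memLp_comp_mul_of_sign hσ (memLp_powExp hs (by positivity))
  have hF := memLp_fourier hg1 hg2
  rw [memLp_two_iff_integrable_sq_norm hF.1] at hF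
  have hF' := ((hF.comp_div (by positivity : (2 * Real.pi) ≠ 0)).const_mul
    ((p ^ (-(1 + 2 * s.re))) ^ 2 / (2 * Real.pi)))
  refine hF'.congr ?_
  rw [← restrict_compl_zero]
  refine (ae_restrict_iff' (measurableSet_singleton (0 : ℝ)).compl).2
    (Filter.Eventually.of_forall fun η hη => ?_)
  have hη : η ≠ 0 := by simpa using hη
  have hσ1 : |σ| = 1 := by rcases hσ with rfl | rfl <;> simp
  simp only
  rw [transform_powExp_comp_neg_inv hs hp hσ hη]
  simp only [norm_mul, norm_div, Complex.norm_I, Complex.norm_real, Real.norm_eq_abs, hσ1,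
    abs_of_nonneg (Real.sqrt_nonneg _), abs_of_nonneg (Real.rpow_nonneg hp.le _), one_mul, mul_pow,
    div_pow, sq_abs, smul_eq_mul]
  rw [Real.sq_sqrt (by positivity)]
  field_simp

-- The factor η from each transform cancels the Jacobian η⁻² of ω = -1/η. Plancherel then leaves
-- Gamma integrals on the same half-line, and zero on opposite ones.
open FourierTransform in
theorem integral_conj_transform_mul_transform {s : ℂ} (hs : -(1 / 2 : ℝ) < s.re) {p q σ τ : ℝ}
    (hp : 0 < p) (hq : 0 < q) (hσ : σ = 1 ∨ σ = -1) (hτ : τ = 1 ∨ τ = -1) :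
    ∫ ω, conj (transform s (fun x => powExp (conj s) p (σ * x)) ω) *
        transform s (fun x => powExp (conj s) q (τ * x)) ω =
      ∫ x, conj (powExp (conj s) p (σ * x)) * powExp (conj s) q (τ * x) := by
  have hs' : -(1 / 2 : ℝ) < (conj s).re := by simpa using hs
  have hint : ∀ {p σ : ℝ}, 0 < p → (σ = 1 ∨ σ = -1) →
      Integrable (fun x => powExp s (1 / p) (σ * x)) := fun hp hσ =>
    integrable_comp_mul_of_sign hσ (integrable_powExp (by linarith) (by positivity))
  have hmem : ∀ {p σ : ℝ}, 0 < p → (σ = 1 ∨ σ = -1) →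
      MemLp (fun x => powExp s (1 / p) (σ * x)) 2 := fun hp hσ =>
    memLp_comp_mul_of_sign hσ (memLp_powExp hs (by positivity))
  have hsq : ((Real.sqrt (2 * Real.pi) : ℝ) : ℂ) * (Real.sqrt (2 * Real.pi) : ℝ) = 2 * Real.pi := by
    rw [← Complex.ofReal_mul, Real.mul_self_sqrt (by positivity)]
    push_cast; ring
  have hpi : (Real.pi : ℂ) ≠ 0 := by exact_mod_cast Real.pi_ne_zero
  have h1 : ∫ ω, conj (transform s (fun x => powExp (conj s) p (σ * x)) ω) *
        transform s (fun x => powExp (conj s) q (τ * x)) ω =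
      σ * τ * ((p ^ (-(1 + 2 * s.re)) : ℝ) : ℂ) * ((q ^ (-(1 + 2 * s.re)) : ℝ) : ℂ) *
        ∫ x, conj (powExp s (1 / p) (σ * x)) * powExp s (1 / q) (τ * x) := by
    rw [← integral_conj_fourier_mul_fourier (hint hp hσ) (hmem hp hσ) (hint hq hτ) (hmem hq hτ),
      integral_eq_integral_comp_neg_inv]
    have h2 := div_two_pi_integral fun ξ => conj (𝓕 (fun x => powExp s (1 / p) (σ * x)) ξ) *
      𝓕 (fun x => powExp s (1 / q) (τ * x)) ξ
    have h3 : ∫ ξ, conj (𝓕 (fun x => powExp s (1 / p) (σ * x)) ξ) *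
        𝓕 (fun x => powExp s (1 / q) (τ * x)) ξ = (1 / (2 * Real.pi)) *
        ∫ η, conj (𝓕 (fun x => powExp s (1 / p) (σ * x)) (η / (2 * Real.pi))) *
        𝓕 (fun x => powExp s (1 / q) (τ * x)) (η / (2 * Real.pi)) := by
      rw [h2]; field_simp
    rw [h3, ← mul_assoc, ← integral_const_mul]
    refine integral_congr_ae ?_
    rw [← restrict_compl_zero]
    refine (ae_restrict_iff' (measurableSet_singleton (0 : ℝ)).compl).2
      (Filter.Eventually.of_forall fun η hη => ?_)
    have hη : η ≠ 0 := by simpa using hη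
    have hηC : (η : ℂ) ≠ 0 := by exact_mod_cast hη
    simp only
    rw [transform_powExp_comp_neg_inv hs hp hσ hη, transform_powExp_comp_neg_inv hs hq hτ hη, ← hsq]
    generalize 𝓕 (fun x => powExp s (1 / p) (σ * x)) (η / (2 * Real.pi)) = A
    generalize 𝓕 (fun x => powExp s (1 / q) (τ * x)) (η / (2 * Real.pi)) = B
    have hsq0 : ((Real.sqrt (2 * Real.pi) : ℝ) : ℂ) ≠ 0 := by
      exact_mod_cast (Real.sqrt_pos.2 (by positivity)).ne'
    simp only [map_mul, map_div₀, Complex.conj_I, Complex.conj_ofReal, Complex.real_smul]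
    push_cast
    generalize ((Real.sqrt (2 * Real.pi) : ℝ) : ℂ) = r at hsq0
    field_simp
    linear_combination (-(σ : ℂ) * conj A * B * τ * ((p ^ (-(1 + 2 * s.re)) : ℝ) : ℂ) *
      ((q ^ (-(1 + 2 * s.re)) : ℝ) : ℂ)) * Complex.I_sq
  rw [h1]
  rcases eq_or_ne σ τ with rfl | hne
  · have hσ2 : σ * σ = 1 := by rcases hσ with rfl | rfl <;> norm_num
    rw [integral_comp_mul_of_sign hσ (fun x => conj (powExp s (1 / p) x) * powExp s (1 / q) x),
      integral_comp_mul_of_sign hσ (fun x => conj (powExp (conj s) p x) * powExp (conj s) q x),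
      integral_conj_powExp_mul_powExp hs (by positivity) (by positivity),
      integral_conj_powExp_mul_powExp hs' hp hq, Complex.conj_re]
    -- This is p⁻¹ q⁻¹ / (1/p + 1/q) = 1/(p + q), raised to the power 1 + 2 Re s.
    have hpow : p ^ (-(1 + 2 * s.re)) * q ^ (-(1 + 2 * s.re)) *
        (1 / (1 / p + 1 / q)) ^ (1 + 2 * s.re) = (1 / (p + q)) ^ (1 + 2 * s.re) := by
      rw [Real.rpow_neg hp.le, Real.rpow_neg hq.le, ← Real.inv_rpow hp.le, ← Real.inv_rpow hq.le,
        ← Real.mul_rpow (by positivity) (by positivity),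
        ← Real.mul_rpow (by positivity) (by positivity)]
      congr 1
      field_simp
      ring
    rw [← Complex.ofReal_mul σ σ, hσ2, ← hpow]
    push_cast
    ring
  · rw [integral_conj_powExp_mul_powExp_comp_of_ne hσ hτ hne,
      integral_conj_powExp_mul_powExp_comp_of_ne hσ hτ hne, mul_zero]

/-! ### Totality of the power-exponential functions -/

/-- In the variable u = e^{-x} a test function becomes a continuous function on [0, 1], which
polynomials approximate uniformly; k annihilates all polynomials in u. -/
theorem ae_eq_zero_of_integral_exp_neg_nat_mul {k : ℝ → ℂ} (hk : IntegrableOn k (Set.Ioi 0))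
    (h0 : ∀ n : ℕ, ∫ x in Set.Ioi (0 : ℝ), ((Real.exp (-x) ^ n : ℝ) : ℂ) * k x = 0) :
    ∀ᵐ x : ℝ, x ∈ Set.Ioi (0 : ℝ) → k x = 0 := by
  refine isOpen_Ioi.ae_eq_zero_of_integral_contDiff_smul_eq_zero hk.locallyIntegrableOn
    fun g hg hgs hgt => ?_
  have hg0 : ∀ x : ℝ, x ≤ 0 → g x = 0 := fun x hx =>
    image_eq_zero_of_notMem_tsupport fun h => not_lt.2 hx (hgt h)
  obtain ⟨R, hR⟩ : ∃ R : ℝ, ∀ x, R < x → g x = 0 := by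
    obtain ⟨R, hR⟩ := hgs.isCompact.isBounded.bddAbove
    exact ⟨R, fun x hx => image_eq_zero_of_notMem_tsupport fun h => not_lt.2 (hR h) hx⟩
  -- Near u = 0 this vanishes because g has bounded support; at u = 0 itself the convention log 0 =
  -- 0 gives g 0 = 0.
  set G : ℝ → ℝ := fun u => g (-Real.log u) with hG
  have hGc : ContinuousOn G (Set.Icc 0 1) := by
    intro u hu
    rcases hu.1.eq_or_lt with rfl | hu0
    · have hev : G =ᶠ[nhdsWithin 0 (Set.Icc 0 1)] fun _ => (0 : ℝ) := by
        have h1 : ∀ᶠ u in nhdsWithin (0 : ℝ) (Set.Icc 0 1), u < Real.exp (-R) :=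
          mem_nhdsWithin_of_mem_nhds (Iio_mem_nhds (Real.exp_pos _))
        filter_upwards [h1, self_mem_nhdsWithin] with u hu1 hu2
        rcases hu2.1.eq_or_lt with rfl | hu0
        · simp [hG, hg0]
        · refine hR _ ?_
          have := (Real.log_lt_iff_lt_exp hu0).2 hu1
          linarith
      refine (continuousWithinAt_const (b := (0 : ℝ))).congr_of_eventuallyEq hev ?_
      simp [hG, hg0]
    · exact (hg.continuous.continuousAt.comp
        (Real.continuousAt_log hu0.ne').neg).continuousWithinAt
  set I := ∫ x in Set.Ioi (0 : ℝ), ‖k x‖ with hI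
  have hI0 : 0 ≤ I := integral_nonneg fun x => norm_nonneg _
  have hset : ∫ x, g x • k x = ∫ x in Set.Ioi (0 : ℝ), g x • k x := by
    rw [← integral_indicator measurableSet_Ioi]
    congr 1
    ext x
    by_cases hx : x ∈ Set.Ioi (0 : ℝ)
    · rw [Set.indicator_of_mem hx]
    · rw [Set.indicator_of_notMem hx, hg0 x (not_lt.1 hx), zero_smul]
  rw [hset]
  refine norm_le_zero_iff.1 (le_of_forall_pos_le_add fun ε hε => ?_)
  obtain ⟨P, hP⟩ := exists_polynomial_near_of_continuousOn 0 1 G hGc (ε / (I + 1)) (by positivity)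
  have hexp : ∀ x : ℝ, 0 < x → Real.exp (-x) ∈ Set.Icc (0 : ℝ) 1 := fun x hx =>
    ⟨(Real.exp_pos _).le, Real.exp_le_one_iff.2 (by linarith)⟩
  have hpow : ∀ n : ℕ, IntegrableOn (fun x : ℝ => ((Real.exp (-x) ^ n : ℝ) : ℂ) * k x)
      (Set.Ioi 0) := by
    intro n
    refine hk.norm.mono' (AEStronglyMeasurable.mul ?_ hk.1)
      ((ae_restrict_iff' measurableSet_Ioi).2 (Filter.Eventually.of_forall fun x hx => ?_))
    · exact (by fun_prop : Continuous fun x : ℝ =>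
        ((Real.exp (-x) ^ n : ℝ) : ℂ)).aestronglyMeasurable
    · have h1 := hexp x hx
      rw [norm_mul, Complex.norm_real, Real.norm_of_nonneg (pow_nonneg h1.1 _)]
      exact mul_le_of_le_one_left (norm_nonneg _) (pow_le_one₀ h1.1 h1.2)
  have hPx : ∀ x : ℝ, (P.eval (Real.exp (-x))) • k x = ∑ n ∈ Finset.range (P.natDegree + 1),
      (P.coeff n : ℂ) * (((Real.exp (-x) ^ n : ℝ) : ℂ) * k x) := by
    intro x
    rw [Polynomial.eval_eq_sum_range, Complex.real_smul, Complex.ofReal_sum, Finset.sum_mul]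
    refine Finset.sum_congr rfl fun n _ => ?_
    push_cast
    ring
  have hPint : IntegrableOn (fun x : ℝ => (P.eval (Real.exp (-x))) • k x) (Set.Ioi 0) := by
    simp only [hPx]
    exact integrable_finsetSum _ fun n _ => (hpow n).const_mul _
  have hP0 : ∫ x in Set.Ioi (0 : ℝ), (P.eval (Real.exp (-x))) • k x = 0 := by
    simp only [hPx]
    rw [integral_finsetSum _ fun n _ => (hpow n).const_mul _]
    refine Finset.sum_eq_zero fun n _ => ?_
    rw [integral_const_mul, h0, mul_zero]
  have hclose : ∀ x : ℝ, 0 < x → |g x - P.eval (Real.exp (-x))| ≤ ε / (I + 1) := by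
    intro x hx
    have := hP _ (hexp x hx)
    simp only [hG, Real.log_exp, neg_neg] at this
    rw [abs_sub_comm]
    exact this.le
  have hgint : IntegrableOn (fun x : ℝ => g x • k x) (Set.Ioi 0) := by
    obtain ⟨M, hM⟩ := hg.continuous.bounded_above_of_compact_support hgs
    exact Integrable.bdd_smul (C := M) hk hg.continuous.aestronglyMeasurable
      (Filter.Eventually.of_forall hM)
  have hdiff : ∫ x in Set.Ioi (0 : ℝ), g x • k x =
      ∫ x in Set.Ioi (0 : ℝ), (g x - P.eval (Real.exp (-x))) • k x := by
    simp only [sub_smul]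
    rw [integral_sub hgint hPint, hP0, sub_zero]
  rw [hdiff, zero_add]
  calc _ ≤ ∫ x in Set.Ioi (0 : ℝ), ε / (I + 1) * ‖k x‖ := by
        refine norm_integral_le_of_norm_le (hk.norm.const_mul _)
          ((ae_restrict_iff' measurableSet_Ioi).2 (Filter.Eventually.of_forall fun x hx => ?_))
        rw [norm_smul, Real.norm_eq_abs]
        exact mul_le_mul_of_nonneg_right (hclose x hx) (norm_nonneg _)
    _ = ε / (I + 1) * I := integral_const_mul _ _
    _ ≤ ε := by
        rw [div_mul_eq_mul_div, div_le_iff₀ (by positivity)]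
        nlinarith

/-- On each half-line the previous result applies to x^a e^{-x} h(σx), whose weight never vanishes;
the exponents p = n + 1 suffice. -/
theorem ae_eq_zero_of_integral_powExp_comp_mul {a : ℂ} {h : ℝ → ℂ}
    (hi : ∀ σ : ℝ, σ = 1 ∨ σ = -1 → Integrable fun x => powExp a 1 (σ * x) * h x)
    (h0 : ∀ p σ : ℝ, 0 < p → (σ = 1 ∨ σ = -1) → ∫ x, powExp a p (σ * x) * h x = 0) :
    h =ᵐ[volume] 0 := by
  have half : ∀ σ : ℝ, σ = 1 ∨ σ = -1 → ∀ᵐ x : ℝ, 0 < x → h (σ * x) = 0 := by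
    intro σ hσ
    have hσ2 : ∀ x : ℝ, σ * (σ * x) = x := fun x => by
      rcases hσ with rfl | rfl <;> ring
    have hk : IntegrableOn (fun x => powExp a 1 x * h (σ * x)) (Set.Ioi 0) := by
      have := integrable_comp_mul_of_sign hσ (hi σ hσ)
      simp only [hσ2] at this
      exact this.integrableOn
    have := ae_eq_zero_of_integral_exp_neg_nat_mul hk fun n => ?_
    · filter_upwards [this] with x hx hx0
      have h1 := hx hx0
      rw [powExp_of_pos a 1 hx0] at h1
      refine (mul_eq_zero.1 h1).resolve_left (mul_ne_zero (Complex.exp_ne_zero _) ?_)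
      rw [Complex.cpow_def_of_ne_zero (by exact_mod_cast hx0.ne')]
      exact Complex.exp_ne_zero _
    · have h1 := h0 (n + 1) σ (by positivity) hσ
      rw [← integral_comp_mul_of_sign hσ] at h1
      simp only [hσ2] at h1
      rw [← h1, ← integral_indicator measurableSet_Ioi]
      congr 1
      ext x
      by_cases hx : x ∈ Set.Ioi (0 : ℝ)
      · rw [Set.indicator_of_mem hx, powExp_of_pos a 1 hx, powExp_of_pos a _ hx]
        have e : Complex.exp (-((n + 1 : ℝ) : ℂ) * x) =
            ((Real.exp (-x) ^ n : ℝ) : ℂ) * Complex.exp (-((1 : ℝ) : ℂ) * x) := by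
          rw [← Real.exp_nat_mul, Complex.ofReal_exp, ← Complex.exp_add]
          congr 1
          push_cast
          ring
        rw [e]
        ring
      · rw [Set.indicator_of_notMem hx, powExp_of_nonpos a _ (not_lt.1 hx), zero_mul]
  have h1 := half 1 (Or.inl rfl)
  have h2 := (Measure.measurePreserving_neg (volume : Measure ℝ)).quasiMeasurePreserving.ae
    (half (-1) (Or.inr rfl))
  have h3 : ∀ᵐ x : ℝ, x ≠ 0 := Measure.ae_ne volume 0
  filter_upwards [h1, h2, h3] with x hx1 hx2 hx3
  rcases lt_or_gt_of_ne hx3 with hx | hx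
  · simpa using hx2 (by simpa using hx)
  · simpa using hx1 hx

/-! ### Isometries with prescribed values on a total family -/

/-- Equal Gram matrices give equal norms for corresponding finite combinations, so the map is well
defined and isometric on a dense subspace. -/
theorem exists_linearIsometry_of_inner_eq {ι H : Type*} [NormedAddCommGroup H]
    [InnerProductSpace ℂ H] [CompleteSpace H] {v w : ι → H}
    (hv : (Submodule.span ℂ (Set.range v)).topologicalClosure = ⊤)
    (hvw : ∀ i j, inner ℂ (w i) (w j) = inner ℂ (v i) (v j)) :
    ∃ U : H →ₗᵢ[ℂ] H, ∀ i, U (v i) = w i := by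
  set V := Finsupp.linearCombination ℂ v with hV
  set W := Finsupp.linearCombination ℂ w with hW
  have hinner : ∀ c d : ι →₀ ℂ, inner ℂ (W c) (W d) = inner ℂ (V c) (V d) := by
    intro c d
    induction c using Finsupp.induction_linear with
    | zero => simp
    | add c c' hc hc' => rw [map_add, map_add, inner_add_left, inner_add_left, hc, hc']
    | single i a =>
      induction d using Finsupp.induction_linear with
      | zero => simp
      | add d d' hd hd' => rw [map_add, map_add, inner_add_right, inner_add_right, hd, hd']
      | single j b =>
        simp only [hV, hW, Finsupp.linearCombination_single, inner_smul_left, inner_smul_right, hvw]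
  have hnorm : ∀ c, ‖W c‖ = ‖V c‖ := fun c => by
    rw [norm_eq_sqrt_re_inner (𝕜 := ℂ), norm_eq_sqrt_re_inner (𝕜 := ℂ), hinner]
  have hdense : DenseRange V := by
    have h1 : Set.range V = (Submodule.span ℂ (Set.range v) : Set H) := by
      rw [← Finsupp.range_linearCombination]
      rfl
    rw [DenseRange, h1]
    exact Submodule.dense_iff_topologicalClosure_eq_top.2 hv
  set U := W.extendOfNorm V with hU
  have hUV : ∀ c, U (V c) = W c := fun c =>
    LinearMap.extendOfNorm_eq hdense ⟨1, fun x => by rw [one_mul, hnorm]⟩ c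
  have hUnorm : ∀ x, ‖U x‖ = ‖x‖ := fun x =>
    hdense.induction_on (p := fun x => ‖U x‖ = ‖x‖) x
      (isClosed_eq (by fun_prop) continuous_norm) fun c => by rw [hUV, hnorm]
  refine ⟨⟨U.toLinearMap, hUnorm⟩, fun i => ?_⟩
  have := hUV (Finsupp.single i 1)
  simpa [hV, hW] using this

/-! ### Weighted integrability and Fubini -/

/-- A weight dominating the generalized exponent: `|𝒯_s(ωx)| ≤ C w(ω) w(x)`. -/
def weight (s : ℂ) (x : ℝ) : ℝ := 1 + |x| ^ min s.re 0

theorem weight_pos (s : ℂ) (x : ℝ) : 0 < weight s x := by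
  unfold weight
  positivity

theorem measurable_weight (s : ℂ) : Measurable (weight s) :=
  measurable_const.add (measurable_norm.pow_const _)

theorem norm_weight (s : ℂ) (x : ℝ) : ‖(weight s x : ℂ)‖ = weight s x := by
  rw [Complex.norm_real, Real.norm_of_nonneg (weight_pos s x).le]

theorem exists_norm_genExp_mul_le {s : ℂ} (hs : -(1 / 2 : ℝ) < s.re) :
    ∃ C : ℝ, 0 ≤ C ∧ ∀ ω x : ℝ, ‖genExp s (ω * x)‖ ≤ C * (weight s ω * weight s x) := by
  obtain ⟨C, hC0, hC⟩ := exists_norm_genExp_le hs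
  refine ⟨C, hC0, fun ω x => (hC _).trans (mul_le_mul_of_nonneg_left ?_ hC0)⟩
  rw [abs_mul, Real.mul_rpow (abs_nonneg _) (abs_nonneg _)]
  unfold weight
  nlinarith [Real.rpow_nonneg (abs_nonneg ω) (min s.re 0),
    Real.rpow_nonneg (abs_nonneg x) (min s.re 0)]

/-- Functions integrable against the weight. On these the transform is absolutely convergent. -/
def WeightedIntegrable (s : ℂ) (f : ℝ → ℂ) : Prop := Integrable fun x => (weight s x : ℂ) * f x

namespace WeightedIntegrable

variable {s : ℂ} {f g : ℝ → ℂ}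

theorem congr (hf : WeightedIntegrable s f) (h : f =ᵐ[volume] g) : WeightedIntegrable s g :=
  Integrable.congr hf (by filter_upwards [h] with x hx; rw [hx])

theorem aestronglyMeasurable (hf : WeightedIntegrable s f) : AEStronglyMeasurable f := by
  have h := ((Complex.measurable_ofReal.comp (measurable_weight s)).inv.aestronglyMeasurable).mul
    (Integrable.aestronglyMeasurable hf)
  refine h.congr (Filter.Eventually.of_forall fun x => ?_)
  have : (weight s x : ℂ) ≠ 0 := by exact_mod_cast (weight_pos s x).ne'
  simp [this]

theorem integrable_genExp_mul (hf : WeightedIntegrable s f) (hs : -(1 / 2 : ℝ) < s.re) (ω : ℝ) :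
    Integrable fun x => genExp s (ω * x) * f x := by
  obtain ⟨C, hC0, hC⟩ := exists_norm_genExp_mul_le hs
  refine (Integrable.norm hf |>.const_mul (C * weight s ω)).mono'
    (((measurable_genExp hs).comp (measurable_const_mul ω)).aestronglyMeasurable.mul
      hf.aestronglyMeasurable) (Filter.Eventually.of_forall fun x => ?_)
  rw [norm_mul, norm_mul, norm_weight, mul_assoc, ← mul_assoc (weight s ω), ← mul_assoc]
  exact mul_le_mul_of_nonneg_right (hC ω x) (norm_nonneg _)

theorem integrable_prod (hf : WeightedIntegrable s f) (hg : WeightedIntegrable s g)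
    (hs : -(1 / 2 : ℝ) < s.re) :
    Integrable (fun z : ℝ × ℝ => genExp s (z.1 * z.2) * f z.2 * g z.1)
      ((volume : Measure ℝ).prod volume) := by
  obtain ⟨C, hC0, hC⟩ := exists_norm_genExp_mul_le hs
  refine ((Integrable.mul_prod (Integrable.norm hg) (Integrable.norm hf)).const_mul C).mono'
    ((((measurable_genExp hs).comp
      (measurable_fst.mul measurable_snd)).aestronglyMeasurable.mul
        hf.aestronglyMeasurable.comp_snd).mul hg.aestronglyMeasurable.comp_fst)
    (Filter.Eventually.of_forall fun z => ?_)
  simp only [norm_mul, norm_weight]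
  calc _ ≤ C * (weight s z.1 * weight s z.2) * ‖f z.2‖ * ‖g z.1‖ := by
        gcongr
        exact hC _ _
    _ = _ := by ring

/-- Fubini together with the symmetry of 𝒯_s(ωx) in ω and x. -/
theorem integral_transform_mul (hf : WeightedIntegrable s f) (hg : WeightedIntegrable s g)
    (hs : -(1 / 2 : ℝ) < s.re) :
    ∫ ω, transform s f ω * g ω = ∫ x, f x * transform s g x := by
  unfold transform
  simp only [← integral_mul_const, ← integral_const_mul]
  rw [integral_integral_swap (f := fun ω x => genExp s (ω * x) * f x * g ω)
    (hf.integrable_prod hg hs)]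
  congr 1
  ext x
  congr 1
  ext ω
  rw [mul_comm x ω]
  ring

theorem integrable_transform_mul (hf : WeightedIntegrable s f) (hg : WeightedIntegrable s g)
    (hs : -(1 / 2 : ℝ) < s.re) : Integrable fun ω => transform s f ω * g ω := by
  refine (hf.integrable_prod hg hs).integral_prod_left.congr
    (Filter.Eventually.of_forall fun ω => ?_)
  simp only [transform, integral_mul_const]

end WeightedIntegrable

theorem abs_rpow_mul_powExp (a : ℂ) (p m : ℝ) (x : ℝ) :
    ((|x| ^ m : ℝ) : ℂ) * powExp a p x = powExp (a + m) p x := by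
  rcases le_or_gt x 0 with hx | hx
  · rw [powExp_of_nonpos _ _ hx, powExp_of_nonpos _ _ hx, mul_zero]
  · rw [powExp_of_pos _ _ hx, powExp_of_pos _ _ hx, abs_of_pos hx, Complex.ofReal_cpow hx.le,
      Complex.cpow_add _ _ (by exact_mod_cast hx.ne')]
    ring

theorem weightedIntegrable_powExp {s a : ℂ} (hs : -(1 / 2 : ℝ) < s.re) (ha : -(1 / 2 : ℝ) < a.re)
    {p σ : ℝ} (hp : 0 < p) (hσ : σ = 1 ∨ σ = -1) :
    WeightedIntegrable s fun x => powExp a p (σ * x) := by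
  have habs : ∀ x : ℝ, |σ * x| = |x| := by rcases hσ with rfl | rfl <;> simp
  have h1 := integrable_comp_mul_of_sign hσ (integrable_powExp (by linarith : -1 < a.re) hp)
  have hm : -(1 / 2 : ℝ) < min s.re 0 := lt_min hs (by norm_num)
  have h2 := integrable_comp_mul_of_sign hσ (integrable_powExp
    (a := a + ((min s.re 0 : ℝ) : ℂ)) (by rw [Complex.add_re, Complex.ofReal_re]; linarith) hp)
  refine (h1.add h2).congr (Filter.Eventually.of_forall fun x => ?_)
  simp only [Pi.add_apply, ← abs_rpow_mul_powExp, habs, weight]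
  push_cast
  ring

theorem rpow_le_exp_one_mul_norm_powExp {m x : ℝ} (hx : 0 < x) (hx1 : x ≤ 1) :
    x ^ m ≤ Real.exp 1 * ‖powExp m 1 x‖ := by
  rw [norm_powExp_of_pos _ _ hx, Complex.ofReal_re, mul_left_comm, ← Real.exp_add]
  exact le_mul_of_one_le_right (Real.rpow_nonneg hx.le _) (Real.one_le_exp (by linarith))

/-- Dominates the singular part of the weight by functions whose integrability is already known. -/
theorem abs_rpow_le {m x : ℝ} (hm : m ≤ 0) (hx : x ≠ 0) :
    |x| ^ m ≤ 1 + Real.exp 1 * (‖powExp m 1 x‖ + ‖powExp m 1 (-1 * x)‖) := by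
  rcases le_or_gt 1 |x| with h | h
  · exact (Real.rpow_le_one_of_one_le_of_nonpos h hm).trans (le_add_of_nonneg_right (by positivity))
  · refine (rpow_le_exp_one_mul_norm_powExp (abs_pos.2 hx) h.le).trans ?_
    have : ‖powExp m 1 |x|‖ ≤ ‖powExp m 1 x‖ + ‖powExp m 1 (-1 * x)‖ := by
      rcases abs_cases x with ⟨h, -⟩ | ⟨h, -⟩ <;> rw [h]
      · linarith [norm_nonneg (powExp m 1 (-1 * x))]
      · rw [neg_one_mul]
        linarith [norm_nonneg (powExp m 1 x)]
    nlinarith [Real.exp_pos 1]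

theorem weightedIntegrable_of_memLp {s : ℂ} (hs : -(1 / 2 : ℝ) < s.re) {f : ℝ → ℂ}
    (h1 : MemLp f 1) (hf : MemLp f ∞) : WeightedIntegrable s f := by
  have hm : -(1 / 2 : ℝ) < min s.re 0 := lt_min hs (by norm_num)
  have hf1 := memLp_one_iff_integrable.1 h1
  have hw : Integrable (powExp (min s.re 0 : ℝ) 1) :=
    integrable_powExp (by rw [Complex.ofReal_re]; linarith) one_pos
  have hw' := integrable_comp_mul_of_sign (Or.inr rfl : (-1 : ℝ) = 1 ∨ (-1 : ℝ) = -1) hw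
  refine (((hf1.norm.const_mul 2).add (((hw.smul_of_top_left hf).norm.add
    (hw'.smul_of_top_left hf).norm).const_mul (Real.exp 1)))).mono'
    ((Complex.measurable_ofReal.comp (measurable_weight s)).aestronglyMeasurable.mul hf.1) ?_
  filter_upwards [Measure.ae_ne volume (0 : ℝ)] with x hx
  simp only [Pi.add_apply, Pi.smul_apply', smul_eq_mul, norm_mul, norm_weight]
  have h := mul_le_mul_of_nonneg_right (abs_rpow_le (min_le_right s.re 0) hx) (norm_nonneg (f x))
  rw [weight]
  linarith

theorem memLp_unitInd_mul_weight {s : ℂ} (hs : -(1 / 2 : ℝ) < s.re) :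
    MemLp (fun t => unitInd t * (weight s t : ℂ)) 2 := by
  have hm : -(1 / 2 : ℝ) < min s.re 0 := lt_min hs (by norm_num)
  refine (memLp_powExp (a := (min s.re 0 : ℝ)) (p := 1) (by simpa using hm) one_pos).of_le_mul
    (c := 2 * Real.exp 1) ?_ ?_
  · exact memLp_unitInd.1.mul
      (Complex.measurable_ofReal.comp (measurable_weight s)).aestronglyMeasurable
  · filter_upwards [Measure.ae_ne volume (0 : ℝ)] with t ht
    by_cases h : t ∈ Set.Icc (0 : ℝ) 1
    · have ht0 : 0 < t := lt_of_le_of_ne h.1 ht.symm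
      rw [unitInd, Set.indicator_of_mem h, one_mul, norm_weight, weight, abs_of_pos ht0, mul_assoc]
      have h1 := rpow_le_exp_one_mul_norm_powExp (m := min s.re 0) ht0 h.2
      have h2 : 1 ≤ t ^ min s.re 0 :=
        Real.one_le_rpow_of_pos_of_le_one_of_nonpos ht0 h.2 (min_le_right _ _)
      linarith
    · rw [unitInd, Set.indicator_of_notMem h, zero_mul, norm_zero]
      positivity

/-- Cauchy–Schwarz: min(Re s, 0) > -1/2 makes the weight square integrable on [0, 1]. -/
theorem weightedIntegrable_unitInd_mul {s : ℂ} (hs : -(1 / 2 : ℝ) < s.re) {k : ℝ → ℂ}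
    (hk : MemLp k 2) : WeightedIntegrable s fun t => unitInd t * k t := by
  refine ((memLp_unitInd_mul_weight hs).integrable_mul hk).congr
    (Filter.Eventually.of_forall fun t => ?_)
  simp only [Pi.mul_apply]
  ring

/-! ### The bilinear pairing and dense subspaces of L² -/

/-- The bilinear pairing `∫ f g` on `L²(ℝ)`. -/
def pairing : L2 →L[ℂ] L2 →L[ℂ] ℂ := (ContinuousLinearMap.mul ℂ ℂ).lpPairing volume 2 2

theorem pairing_apply (f g : L2) : pairing f g = ∫ x, f x * g x :=
  ContinuousLinearMap.lpPairing_eq_integral _ f g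

theorem pairing_star_left (f g : L2) : pairing (star f) g = inner ℂ f g := by
  rw [pairing_apply, L2.inner_def]
  refine integral_congr_ae ?_
  filter_upwards [Lp.coeFn_star f] with x hx
  rw [hx, RCLike.inner_apply, mul_comm]
  rfl

theorem pairing_toLp {f g : ℝ → ℂ} (hf : MemLp f 2) (hg : MemLp g 2) :
    pairing (hf.toLp f) (hg.toLp g) = ∫ x, f x * g x := by
  rw [pairing_apply]
  refine integral_congr_ae ?_
  filter_upwards [hf.coeFn_toLp, hg.coeFn_toLp] with x h1 h2
  rw [h1, h2]

theorem pairing_toLp_left {f : ℝ → ℂ} (hf : MemLp f 2) (g : L2) :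
    pairing (hf.toLp f) g = ∫ x, f x * g x := by
  rw [pairing_apply]
  refine integral_congr_ae ?_
  filter_upwards [hf.coeFn_toLp] with x h1
  rw [h1]

theorem conj_powExp (a : ℂ) (p x : ℝ) : conj (powExp a p x) = powExp (conj a) p x := by
  rcases le_or_gt x 0 with hx | hx
  · simp [powExp_of_nonpos _ _ hx]
  · rw [powExp_of_pos _ _ hx, powExp_of_pos _ _ hx, map_mul, ← Complex.exp_conj,
      Complex.cpow_conj _ _ (by
        rw [Complex.arg_ofReal_of_nonneg hx.le]; exact Real.pi_pos.ne), Complex.conj_ofReal]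
    simp

theorem memLp_powExp_comp_mul {a : ℂ} {p σ : ℝ} (ha : -(1 / 2 : ℝ) < a.re) (hp : 0 < p)
    (hσ : σ = 1 ∨ σ = -1) : MemLp (fun x => powExp a p (σ * x)) 2 :=
  memLp_comp_mul_of_sign hσ (memLp_powExp ha hp)

/-- The one-sided functions `e^{-p|x|}|x|^a`, `σx > 0`, span a dense subspace of `L²(ℝ)`. -/
theorem topologicalClosure_span_powExp {a : ℂ} (ha : -(1 / 2 : ℝ) < a.re) :
    (Submodule.span ℂ (Set.range fun i : {r : ℝ × ℝ // 0 < r.1 ∧ (r.2 = 1 ∨ r.2 = -1)} =>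
      (memLp_powExp_comp_mul ha i.2.1 i.2.2).toLp fun x => powExp a i.1.1 (i.1.2 * x)
        )).topologicalClosure = ⊤ := by
  rw [Submodule.topologicalClosure_eq_top_iff, Submodule.eq_bot_iff]
  intro g hg
  have ha' : -(1 / 2 : ℝ) < (conj a).re := by simpa using ha
  have h0 : ∀ p σ : ℝ, 0 < p → (σ = 1 ∨ σ = -1) →
      ∫ x, powExp (conj a) p (σ * x) * g x = 0 := by
    intro p σ hp hσ
    have h := (Submodule.mem_orthogonal _ g).1 hg _
      (Submodule.subset_span ⟨⟨(p, σ), hp, hσ⟩, rfl⟩)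
    rw [L2.inner_def] at h
    rw [← h]
    refine integral_congr_ae ?_
    filter_upwards [(memLp_powExp_comp_mul ha hp hσ).coeFn_toLp] with x hx
    rw [hx, RCLike.inner_apply, conj_powExp, mul_comm]
  have := ae_eq_zero_of_integral_powExp_comp_mul (a := conj a) (h := g) (fun σ hσ =>
    (memLp_powExp_comp_mul ha' one_pos hσ).integrable_mul (Lp.memLp g)) h0
  exact (Lp.eq_zero_iff_ae_eq_zero).2 this

theorem dense_L1_inter_Linf :
    Dense {f : L2 | MemLp f 1 (volume : Measure ℝ) ∧ MemLp f ∞ (volume : Measure ℝ)} := by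
  refine (Lp.simpleFunc.denseRange (E := ℂ) (μ := (volume : Measure ℝ)) (p := 2)
    ENNReal.ofNat_ne_top).mono ?_
  rintro _ ⟨f, rfl⟩
  have hm := Lp.simpleFunc.memLp f
  have hfin := SimpleFunc.memLp_iff (p := 2) two_ne_zero ENNReal.ofNat_ne_top |>.1 hm
  exact ⟨(memLp_congr_ae (Lp.simpleFunc.toSimpleFunc_eq_toFun f)).1
      ((SimpleFunc.memLp_iff one_ne_zero ENNReal.one_ne_top).2 hfin),
    (memLp_congr_ae (Lp.simpleFunc.toSimpleFunc_eq_toFun f)).1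
      (SimpleFunc.memLp_top _ _)⟩

/-! ### The unitary operator -/

theorem exists_linearIsometry_transform {s : ℂ} (hs : -(1 / 2 : ℝ) < s.re) :
    ∃ U : L2 →ₗᵢ[ℂ] L2, (∀ f g, pairing (U f) g = pairing f (U g)) ∧
      ∀ (f : ℝ → ℂ) (hf : MemLp f 2), WeightedIntegrable s f →
        U (hf.toLp f) =ᵐ[volume] transform s f := by
  have hs' : -(1 / 2 : ℝ) < (conj s).re := by simpa using hs
  obtain ⟨U, hU⟩ := exists_linearIsometry_of_inner_eq (topologicalClosure_span_powExp hs')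
    (w := fun i => (memLp_transform_powExp hs i.2.1 i.2.2).toLp _) (by
      intro i j
      rw [L2.inner_def, L2.inner_def]
      refine Eq.trans ?_ (Eq.trans (integral_conj_transform_mul_transform hs i.2.1 j.2.1
        i.2.2 j.2.2) ?_)
      · refine integral_congr_ae ?_
        filter_upwards [(memLp_transform_powExp hs i.2.1 i.2.2).coeFn_toLp,
          (memLp_transform_powExp hs j.2.1 j.2.2).coeFn_toLp] with x h1 h2
        rw [h1, h2, RCLike.inner_apply, mul_comm]
      · refine integral_congr_ae ?_
        filter_upwards [(memLp_powExp_comp_mul hs' i.2.1 i.2.2).coeFn_toLp,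
          (memLp_powExp_comp_mul hs' j.2.1 j.2.2).coeFn_toLp] with x h1 h2
        rw [h1, h2, RCLike.inner_apply, mul_comm])
  have hdense : Dense (Submodule.span ℂ (Set.range
      fun i : {r : ℝ × ℝ // 0 < r.1 ∧ (r.2 = 1 ∨ r.2 = -1)} =>
      (memLp_powExp_comp_mul hs' i.2.1 i.2.2).toLp fun x => powExp (conj s) i.1.1 (i.1.2 * x)
        ) : Set L2) :=
    Submodule.dense_iff_topologicalClosure_eq_top.2 (topologicalClosure_span_powExp hs')
  have hW : ∀ i : {r : ℝ × ℝ // 0 < r.1 ∧ (r.2 = 1 ∨ r.2 = -1)},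
      WeightedIntegrable s fun x => powExp (conj s) i.1.1 (i.1.2 * x) :=
    fun i => weightedIntegrable_powExp hs hs' i.2.1 i.2.2
  have hgen : ∀ i j : {r : ℝ × ℝ // 0 < r.1 ∧ (r.2 = 1 ∨ r.2 = -1)},
      pairing (U ((memLp_powExp_comp_mul hs' i.2.1 i.2.2).toLp _))
        ((memLp_powExp_comp_mul hs' j.2.1 j.2.2).toLp _) =
      pairing ((memLp_powExp_comp_mul hs' i.2.1 i.2.2).toLp _)
        (U ((memLp_powExp_comp_mul hs' j.2.1 j.2.2).toLp _)) := by
    intro i j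
    rw [hU i, hU j, pairing_toLp, pairing_toLp]
    exact (hW i).integral_transform_mul (hW j) hs
  -- Symmetry passes from generators to all of L² by density, in one argument at a time.
  have hsymm1 : ∀ (f : L2) (j : {r : ℝ × ℝ // 0 < r.1 ∧ (r.2 = 1 ∨ r.2 = -1)}),
      pairing (U f) ((memLp_powExp_comp_mul hs' j.2.1 j.2.2).toLp _) =
      pairing f (U ((memLp_powExp_comp_mul hs' j.2.1 j.2.2).toLp _)) := by
    intro f j
    have := ContinuousLinearMap.ext_on hdense
      (f := pairing.flip ((memLp_powExp_comp_mul hs' j.2.1 j.2.2).toLp _) ∘L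
        U.toContinuousLinearMap)
      (g := pairing.flip (U ((memLp_powExp_comp_mul hs' j.2.1 j.2.2).toLp _))) (by
        rintro _ ⟨i, rfl⟩
        exact hgen i j)
    exact DFunLike.congr_fun this f
  have hsymm : ∀ f g, pairing (U f) g = pairing f (U g) := by
    intro f g
    have := ContinuousLinearMap.ext_on hdense (f := pairing (U f))
      (g := pairing f ∘L U.toContinuousLinearMap) (by
        rintro _ ⟨i, rfl⟩
        exact hsymm1 f i)
    exact DFunLike.congr_fun this g
  refine ⟨U, hsymm, fun f hf hfW => ?_⟩
  have hint1 : ∀ p σ : ℝ, 0 < p → (σ = 1 ∨ σ = -1) →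
      Integrable fun x => powExp (conj s) p (σ * x) * U (hf.toLp f) x := fun p σ hp hσ =>
    (memLp_powExp_comp_mul hs' hp hσ).integrable_mul (Lp.memLp _)
  have hint2 : ∀ p σ : ℝ, 0 < p → (σ = 1 ∨ σ = -1) →
      Integrable fun x => powExp (conj s) p (σ * x) * transform s f x := fun p σ hp hσ =>
    (hfW.integrable_transform_mul (weightedIntegrable_powExp hs hs' hp hσ) hs).congr
      (Filter.Eventually.of_forall fun x => mul_comm _ _)
  -- Against each generator, U f and the integral transform of f give the same value: both move onto
  -- the generator, where U is the transform by construction. Totality then forces equality almost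
  -- everywhere.
  have hzero := ae_eq_zero_of_integral_powExp_comp_mul (a := conj s)
    (h := fun x => U (hf.toLp f) x - transform s f x) (fun σ hσ => by
      simpa only [mul_sub] using! (hint1 1 σ one_pos hσ).sub (hint2 1 σ one_pos hσ))
    (fun p σ hp hσ => by
      simp only [mul_sub]
      rw [integral_sub (hint1 p σ hp hσ) (hint2 p σ hp hσ), sub_eq_zero,
        ← pairing_toLp_left (memLp_powExp_comp_mul hs' hp hσ), ← hsymm,
        hU ⟨(p, σ), hp, hσ⟩, pairing_toLp]
      exact (weightedIntegrable_powExp hs hs' hp hσ).integral_transform_mul hfW hs)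
  filter_upwards [hzero] with x hx
  exact sub_eq_zero.1 hx

theorem adjoint_eq_star_comp_star {U : L2 →ₗᵢ[ℂ] L2}
    (hU : ∀ f g, pairing (U f) g = pairing f (U g)) (k : L2) :
    ContinuousLinearMap.adjoint U.toContinuousLinearMap k = star (U (star k)) := by
  refine ext_inner_right ℂ fun g => ?_
  rw [ContinuousLinearMap.adjoint_inner_left, ← pairing_star_left, ← pairing_star_left, star_star,
    hU]
  rfl

/-- An isometry has U*U = 1. As U* is U conjugated by `star`, applying `star` to this identity
yields UU* = 1. -/
theorem mem_unitary_of_pairing_symm {U : L2 →ₗᵢ[ℂ] L2}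
    (hU : ∀ f g, pairing (U f) g = pairing f (U g)) :
    U.toContinuousLinearMap ∈ unitary (L2 →L[ℂ] L2) := by
  have h1 : ∀ f, star (U (star (U f))) = f := by
    intro f
    rw [← adjoint_eq_star_comp_star hU]
    refine ext_inner_right ℂ fun g => ?_
    rw [ContinuousLinearMap.adjoint_inner_left]
    exact U.inner_map_map f g
  rw [Unitary.mem_iff]
  constructor <;> ext1 f
  · rw [ContinuousLinearMap.star_eq_adjoint]
    simp only [mul_apply_eq_comp, adjoint_eq_star_comp_star hU]
    exact h1 f
  · rw [ContinuousLinearMap.star_eq_adjoint]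
    simp only [mul_apply_eq_comp, adjoint_eq_star_comp_star hU]
    have := h1 (star f)
    rw [star_eq_iff_star_eq] at this
    rw [star_star] at this
    exact this.symm

theorem coeFn_adjoint_mulOp {φ : ℝ → ℂ} (hφ : MemLp φ ∞) (f : L2) :
    ∀ᵐ x : ℝ, ContinuousLinearMap.adjoint (mulOp φ hφ) f x = conj (φ x) * f x := by
  have hφ' : MemLp (fun x => conj (φ x)) ∞ := hφ.star
  have : ContinuousLinearMap.adjoint (mulOp φ hφ) f = mulOp _ hφ' f := by
    refine ext_inner_right ℂ fun g => ?_
    rw [ContinuousLinearMap.adjoint_inner_left, L2.inner_def, L2.inner_def]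
    refine integral_congr_ae ?_
    filter_upwards [coeFn_mulOp φ hφ g, coeFn_mulOp _ hφ' f] with x h1 h2
    rw [h1, h2]
    simp only [RCLike.inner_apply, map_mul, Complex.conj_conj]
    ring
  rw [this]
  exact coeFn_mulOp _ hφ' f

theorem memLp_two_of_memLp_one_of_memLp_top {f : ℝ → ℂ} (h1 : MemLp f 1) (hf : MemLp f ∞) :
    MemLp f 2 := by
  rw [memLp_two_iff_integrable_sq_norm h1.1]
  refine ((memLp_one_iff_integrable.1 h1).norm.smul_of_top_left hf.norm).congr
    (Filter.Eventually.of_forall fun x => ?_)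
  simp [pow_two]

theorem psi_mul_conj {s : ℂ} {x : ℝ} (hx : x ≠ 0) : psi s x * conj (psi s x) = 1 := by
  rw [Complex.mul_conj, Complex.normSq_eq_norm_sq, norm_psi hx]
  simp

theorem mulOp_psi_comp_adjoint (s : ℂ) :
    mulOp (psi s) (memLp_psi s) ∘L ContinuousLinearMap.adjoint (mulOp (psi s) (memLp_psi s)) =
      ContinuousLinearMap.id ℂ L2 := by
  ext1 f
  refine Lp.ext ?_
  filter_upwards [coeFn_mulOp (psi s) (memLp_psi s)
    (ContinuousLinearMap.adjoint (mulOp (psi s) (memLp_psi s)) f),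
    coeFn_adjoint_mulOp (memLp_psi s) f, Measure.ae_ne volume (0 : ℝ)] with x h1 h2 h3
  rw [ContinuousLinearMap.comp_apply, h1, h2, ← mul_assoc, psi_mul_conj h3, one_mul,
    ContinuousLinearMap.id_apply]

/-! ### The integral operator with the confluent hypergeometric kernel -/

theorem memLp_unitInd_mul_conj_genExp {s : ℂ} (hs : -(1 / 2 : ℝ) < s.re) (x : ℝ) :
    MemLp (fun t => unitInd t * conj (genExp s (x * t))) 2 := by
  obtain ⟨C, hC0, hC⟩ := exists_norm_genExp_mul_le hs
  refine (memLp_unitInd_mul_weight hs).of_le_mul (c := C * weight s x) ?_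
    (Filter.Eventually.of_forall fun t => ?_)
  · exact memLp_unitInd.1.mul (Complex.continuous_conj.measurable.comp
      ((measurable_genExp hs).comp (measurable_const_mul x))).aestronglyMeasurable
  · rw [norm_mul, norm_mul, norm_weight, Complex.norm_conj, mul_left_comm, mul_assoc]
    exact mul_le_mul_of_nonneg_left (by simpa only [mul_assoc] using hC x t) (norm_nonneg _)

theorem weightedIntegrable_unitInd_mul_conj_genExp {s : ℂ} (hs : -(1 / 2 : ℝ) < s.re) (x : ℝ) :
    WeightedIntegrable s fun t => unitInd t * conj (genExp s (x * t)) := by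
  refine (weightedIntegrable_unitInd_mul hs (memLp_unitInd_mul_conj_genExp hs x)).congr
    (Filter.Eventually.of_forall fun t => ?_)
  by_cases ht : t ∈ Set.Icc (0 : ℝ) 1 <;> simp [unitInd, ht]

theorem integral_unitInd_mul (F : ℝ → ℂ) :
    ∫ t, unitInd t * F t = ∫ t in (0 : ℝ)..1, F t := by
  rw [intervalIntegral.integral_of_le zero_le_one, ← integral_Icc_eq_integral_Ioc,
    ← integral_indicator measurableSet_Icc]
  congr 1
  ext t
  by_cases h : t ∈ Set.Icc (0 : ℝ) 1 <;> simp [unitInd, h]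

theorem transform_unitInd_mul_conj_genExp {s : ℂ} (hs : -(1 / 2 : ℝ) < s.re) (x y : ℝ) :
    transform s (fun t => unitInd t * conj (genExp s (x * t))) y =
      psi s x * kernel s x y * conj (psi s y) := by
  rw [← integral_conj_genExp_mul_genExp hs x y, ← integral_unitInd_mul]
  unfold transform
  congr 1
  ext t
  ring

/-- The truncation to [0, 1] makes both 𝕀 U h and 𝕀 conj(𝒯_s(x·)) weighted integrable, so that U
acts on them (up to `star`) by the pointwise integral, although h is only in L². -/
theorem isIntegralOperator_kernel {s : ℂ} (hs : -(1 / 2 : ℝ) < s.re) {U : L2 →ₗᵢ[ℂ] L2}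
    (hU : ∀ f g, pairing (U f) g = pairing f (U g))
    (hUt : ∀ (f : ℝ → ℂ) (hf : MemLp f 2), WeightedIntegrable s f →
      U (hf.toLp f) =ᵐ[volume] transform s f) :
    IsIntegralOperator (kernel s)
      (ContinuousLinearMap.adjoint (mulOp (psi s) (memLp_psi s)) ∘L
        (ContinuousLinearMap.adjoint U.toContinuousLinearMap ∘L
          mulOp unitInd memLp_unitInd ∘L U.toContinuousLinearMap) ∘L
          mulOp (psi s) (memLp_psi s)) := by
  intro f
  set h : L2 := mulOp (psi s) (memLp_psi s) f with hh
  set q : L2 := mulOp unitInd memLp_unitInd (U h) with hq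
  have hunit : ∀ t, conj (unitInd t) = unitInd t := fun t => by
    by_cases ht : t ∈ Set.Icc (0 : ℝ) 1 <;> simp [unitInd, ht]
  have hqs : ((star q : L2) : ℝ → ℂ) =ᵐ[volume] fun t => unitInd t * (star (U h) : L2) t := by
    filter_upwards [Lp.coeFn_star q, Lp.coeFn_star (U h), coeFn_mulOp unitInd memLp_unitInd (U h)]
      with t h1 h2 h3
    rw [h1, h2, Pi.star_apply, Pi.star_apply, hq, h3, star_mul', RCLike.star_def, hunit t]
  have hqW : WeightedIntegrable s (star q : L2) :=
    (weightedIntegrable_unitInd_mul hs (Lp.memLp (star (U h)))).congr hqs.symm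
  have hUq := hUt _ (Lp.memLp (star q)) hqW
  rw [Lp.toLp_coeFn] at hUq
  -- The left side is the pairing of 𝕀 conj(𝒯_s(x·)) with U h; symmetry moves U to the first factor,
  -- and its transform is the kernel.
  have hval : ∀ x, conj (transform s (star q : L2) x) =
      ∫ y, transform s (fun t => unitInd t * conj (genExp s (x * t))) y * h y := by
    intro x
    have hW := weightedIntegrable_unitInd_mul_conj_genExp hs x
    have h1 := hUt _ (memLp_unitInd_mul_conj_genExp hs x) hW
    have h2 := hU ((memLp_unitInd_mul_conj_genExp hs x).toLp _) h
    rw [pairing_toLp_left, pairing_apply] at h2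
    rw [integral_congr_ae (g := fun y => U ((memLp_unitInd_mul_conj_genExp hs x).toLp _) y * h y)
      (by filter_upwards [h1] with y hy; rw [hy]), h2, transform, ← integral_conj]
    refine integral_congr_ae ?_
    filter_upwards [hqs, Lp.coeFn_star (U h)] with t h3 h4
    rw [h3, h4, map_mul, map_mul, hunit]
    simp only [Pi.star_apply, RCLike.star_def, Complex.conj_conj]
    ring
  have hint : ∀ x, Integrable fun y =>
      transform s (fun t => unitInd t * conj (genExp s (x * t))) y * h y := by
    intro x
    have hW := weightedIntegrable_unitInd_mul_conj_genExp hs x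
    refine ((Lp.memLp (U ((memLp_unitInd_mul_conj_genExp hs x).toLp _))).integrable_mul
      (Lp.memLp h)).congr ?_
    filter_upwards [hUt _ (memLp_unitInd_mul_conj_genExp hs x) hW] with y hy
    rw [Pi.mul_apply, hy]
  have hker : ∀ x, x ≠ 0 → (fun y => conj (psi s x) *
      (transform s (fun t => unitInd t * conj (genExp s (x * t))) y * h y)) =ᵐ[volume]
      fun y => kernel s x y * f y := by
    intro x hx
    filter_upwards [coeFn_mulOp (psi s) (memLp_psi s) f, Measure.ae_ne volume (0 : ℝ)] with y h1 h2
    rw [transform_unitInd_mul_conj_genExp hs, hh, h1]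
    linear_combination (kernel s x y * f y) *
      ((psi s y * conj (psi s y)) * psi_mul_conj (s := s) hx + psi_mul_conj (s := s) h2)
  filter_upwards [Measure.ae_ne volume (0 : ℝ), hUq, coeFn_adjoint_mulOp (memLp_psi s)
    (ContinuousLinearMap.adjoint U.toContinuousLinearMap q), Lp.coeFn_star (U (star q))]
    with x hx h1 h2 h3
  refine ⟨((hint x).const_mul _).congr (hker x hx), ?_⟩
  rw [← integral_congr_ae (hker x hx), integral_const_mul, ← hval x, ← h1]
  refine h2.trans ?_
  rw [adjoint_eq_star_comp_star hU, h3]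
  rfl

end ConfluentHG

end

theorem theorem1 :
    (∀ s : ℂ, -(1 / 2 : ℝ) < s.re →
      -- the subspace `L¹ ∩ L^∞` is dense in `L²`
      Dense {f : ConfluentHG.L2 | MemLp f 1 (volume : Measure ℝ) ∧ MemLp f ∞ (volume : Measure ℝ)} ∧
      -- the integral defining the transform converges and is isometric on `L¹ ∩ L^∞`
      (∀ f : ℝ → ℂ, MemLp f 1 (volume : Measure ℝ) → MemLp f ∞ (volume : Measure ℝ) →
        (∀ ω : ℝ, ω ≠ 0 → Integrable (fun x : ℝ => ConfluentHG.genExp s (ω * x) * f x)) ∧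
        MemLp (ConfluentHG.transform s f) 2 (volume : Measure ℝ) ∧
        eLpNorm (ConfluentHG.transform s f) 2 (volume : Measure ℝ) =
          eLpNorm f 2 (volume : Measure ℝ)) ∧
      -- it extends to a unitary operator, which diagonalizes the kernel operator
      (∃ T : ConfluentHG.L2 →L[ℂ] ConfluentHG.L2,
        T ∈ unitary (ConfluentHG.L2 →L[ℂ] ConfluentHG.L2) ∧
        (∀ f : ConfluentHG.L2,
          MemLp f 1 (volume : Measure ℝ) → MemLp f ∞ (volume : Measure ℝ) →
            ∀ᵐ ω : ℝ, T f ω = ConfluentHG.transform s f ω) ∧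
        ∃ K : ConfluentHG.L2 →L[ℂ] ConfluentHG.L2,
          ConfluentHG.IsIntegralOperator (ConfluentHG.kernel s) K ∧
          ContinuousLinearMap.adjoint T ∘L
              ConfluentHG.mulOp ConfluentHG.unitInd ConfluentHG.memLp_unitInd ∘L T =
            ConfluentHG.mulOp (ConfluentHG.psi s) (ConfluentHG.memLp_psi s) ∘L K ∘L
              ContinuousLinearMap.adjoint
                (ConfluentHG.mulOp (ConfluentHG.psi s) (ConfluentHG.memLp_psi s))) ∧
      -- the relation between the kernels
      (∀ x y : ℝ,
        IntervalIntegrable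
          (fun t : ℝ => conj (ConfluentHG.genExp s (x * t)) * ConfluentHG.genExp s (y * t))
          volume 0 1 ∧
        ∫ t in (0 : ℝ)..1, conj (ConfluentHG.genExp s (x * t)) * ConfluentHG.genExp s (y * t) =
          ConfluentHG.psi s x * ConfluentHG.kernel s x y * conj (ConfluentHG.psi s y))) ∧
    -- for `s = 0` the transform is the Fourier transform
    (∀ (f : ℝ → ℂ) (ω : ℝ), ConfluentHG.transform 0 f ω = ConfluentHG.fourier f ω) := by
  refine ⟨fun s hs => ?_, ConfluentHG.transform_zero⟩
  obtain ⟨U, hU, hUt⟩ := ConfluentHG.exists_linearIsometry_transform hs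
  refine ⟨ConfluentHG.dense_L1_inter_Linf, fun f h1 hf => ?_, ?_, fun x y =>
    ⟨ConfluentHG.intervalIntegrable_conj_genExp_mul_genExp hs x y,
      ConfluentHG.integral_conj_genExp_mul_genExp hs x y⟩⟩
  · have hW := ConfluentHG.weightedIntegrable_of_memLp hs h1 hf
    have h2 := ConfluentHG.memLp_two_of_memLp_one_of_memLp_top h1 hf
    have hUf := hUt f h2 hW
    refine ⟨fun ω _ => hW.integrable_genExp_mul hs ω, (memLp_congr_ae hUf).1 (Lp.memLp _), ?_⟩
    rw [← eLpNorm_congr_ae hUf, ← Lp.enorm_def, U.enorm_map, Lp.enorm_toLp]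
  · refine ⟨U.toContinuousLinearMap, ConfluentHG.mem_unitary_of_pairing_symm hU,
      fun f h1 hf => ?_, _, ConfluentHG.isIntegralOperator_kernel hs hU hUt, ?_⟩
    · have := hUt f (Lp.memLp f) (ConfluentHG.weightedIntegrable_of_memLp hs h1 hf)
      rwa [Lp.toLp_coeFn] at this
    · have h := ConfluentHG.mulOp_psi_comp_adjoint s
      ext1 f
      have h' := fun g => DFunLike.congr_fun h g
      simp only [ContinuousLinearMap.comp_apply, ContinuousLinearMap.id_apply] at h' ⊢
      rw [h', h']
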